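/- **Setting.** Let $\ell:\mathbb R^d\to(0,\infty)$ be the unnormalized density of a posterior ($\pi\propto\ell$), with $\log\ell$ differentiable, and let $0<\mu$, $0<L$. Assume that $\pi$ is $\mu$-strongly log-concave and $L$-log-smooth: for all $z,z'\in\mathbb R^d$, $$\langle \nabla(-\log\ell)(z),z-z'\rangle\ \ge\ -\log\ell(z)+\log\ell(z')+\tfrac{\mu}{2}\|z-z'\|_2^2,\qquad \|\nabla\log\ell(z)-\nabla\log\ell(z')\|_2\le L\|z-z'\|_2 .$$ Let $\varphi$ be a distribution on $\mathbb R^d$ with i.i.d. components $u_1,\dots,u_d$ such that $\mathbb E u_i=0$, $\mathbb E u_i^2=1$, $\mathbb E u_i^3=0$, $k_\varphi=\mathbb E u_i^4<\infty$, whose common law has a Lebesgue density and finite differential entropy. The variational parameters are $\lambda=(m,C)$ with $m\in\mathbb R^d$ and $C\in\mathbb R^{d\times d}$ lower triangular (full-rank parameterization), with norm $\|\lambda\|_2^2=\|m\|_2^2+\|C\|_{\mathrm F}^2$. Let $\mathcal T_\lambda(u)=Cu+m$, let $q_\lambda$ be the law of $\mathcal T_\lambda(u)$ for $u\sim\varphi$,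 and let $$F(\lambda)=\mathbb E_{z\sim q_\lambda}[-\log\ell(z)]-\mathbb H(q_\lambda)$$ be the negative ELBO, where $\mathbb H$ is the differential entropy. Let $\Lambda_L$ be the set of those $\lambda=(m,C)$ for which all eigenvalues (equivalently, all diagonal entries) of $C$ are at least $1/\sqrt L$. The Euclidean projection $\mathrm{proj}_{\Lambda_L}$ replaces each $C_{ii}$ by $\max(C_{ii},1/\sqrt L)$ and leaves all other entries unchanged. The closed-form entropy (CFE) estimator is $$g(\lambda;u)=-\nabla_\lambda\log\ell(\mathcal T_\lambda(u))-\nabla_\lambda\mathbb H(q_\lambda),$$ and projected SGD with fixed stepsize $\gamma>0$, started at a deterministic $\lambda_0\in\Lambda_L$, is $$\lambda_{t+1}=\mathrm{proj}_{\Lambda_L}\bigl(\lambda_t-\gamma\,g(\lambda_t;u_t)\bigr),\qquad u_0,u_1,\dots\ \text{i.i.d.}\sim\varphi .$$ **Theorem.** Let $\lambda^*=\arg\min_{\lambda\in\Lambda_L}F(\lambda)$, let $\bar z$ be a stationary point of $\log\ell$, $\bar\lambda=(\bar z,0)$, $\kappa=L/\mu$ and $\varepsilon>0$. Then there is a fixed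 stepsize $\gamma>0$, which does not depend on $\lambda_0$ or $T$, such that for every $\lambda_0\in\Lambda_L$, with $\Delta=\|\lambda_0-\lambda^*\|_2$, and every $T\in\mathbb N$ with $$T\ \ge\ 2\kappa^2\,(d+k_\varphi+4)\Bigl(1+2\,\|\bar\lambda-\lambda^*\|_2^2\,\tfrac1\varepsilon\Bigr)\log\Bigl(2\Delta^2\,\tfrac1\varepsilon\Bigr)$$ (when $\Delta=0$: every $T$), the last iterate satisfies $\lambda_T\in\Lambda_L$ and $\mathbb E\|\lambda_T-\lambda^*\|_2^2\le\varepsilon$. -/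

import Mathlib

open MeasureTheory ProbabilityTheory

namespace BBVI

noncomputable section

/-- The space `ℝᵈ` of latent variables, with its Euclidean norm. -/
abbrev Vec (d : ℕ) : Type := EuclideanSpace ℝ (Fin d)

/-- The positions on and below the diagonal of a `d × d` matrix. -/
abbrev LowerIdx (d : ℕ) : Type := {p : Fin d × Fin d // p.2 ≤ p.1}

/-- The variational parameters `λ = (m, C)`: a vector `m ∈ ℝᵈ` and a lower triangular matrix
`C ∈ ℝᵈˣᵈ`, listed by their free entries. The Euclidean norm is
`‖λ‖² = ‖m‖² + ‖C‖_F²` (see `norm_sq_eq`). -/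
abbrev Param (d : ℕ) : Type := EuclideanSpace ℝ (Fin d ⊕ LowerIdx d)

variable {d : ℕ}

/-- The location `m` of `λ = (m, C)`. -/
def loc (lam : Param d) : Fin d → ℝ := fun i => lam (Sum.inl i)

/-- The lower triangular scale matrix `C` of `λ = (m, C)`. -/
def scale (lam : Param d) : Matrix (Fin d) (Fin d) ℝ :=
  Matrix.of fun i j => if h : j ≤ i then lam (Sum.inr ⟨(i, j), h⟩) else 0

/-- The parameter `(z, 0)`. -/
def pointParam (z : Vec d) : Param d := WithLp.toLp 2 (Sum.elim (fun i => z i) (fun _ => 0))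

/-- The norm of the parameter space is `‖m‖² + ‖C‖_F²`. -/
theorem norm_sq_eq (lam : Param d) :
    ‖lam‖ ^ 2 = ∑ i, loc lam i ^ 2 + ∑ i, ∑ j, scale lam i j ^ 2 := by
  rw [EuclideanSpace.real_norm_sq_eq, Fintype.sum_sum_type]
  congr 1
  rw [← Fintype.sum_prod_type' (f := fun i j => scale lam i j ^ 2)]
  rw [← Fintype.sum_subtype_add_sum_subtype (fun p : Fin d × Fin d => p.2 ≤ p.1)
    (fun p => scale lam p.1 p.2 ^ 2)]
  have h0 : ∑ p : {p : Fin d × Fin d // ¬ p.2 ≤ p.1}, scale lam p.1.1 p.1.2 ^ 2 = 0 :=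
    Finset.sum_eq_zero fun p _ => by simp [scale, p.2]
  rw [h0, add_zero]
  refine Finset.sum_congr rfl fun p _ => ?_
  simp [scale, p.2]

/-- The location-scale reparameterization `T_λ(u) = C u + m`. -/
def reparam (lam : Param d) (u : Fin d → ℝ) : Vec d :=
  WithLp.toLp 2 ((scale lam).mulVec u + loc lam)

/-- The base distribution `φ` on `ℝᵈ`: i.i.d. components with law `ν`. -/
def base (d : ℕ) (ν : Measure ℝ) : Measure (Fin d → ℝ) := Measure.pi fun _ => ν

/-- The assumptions on the common law `ν` of the components of the base distribution: it is
standardized, has zero third moment and finite fourth moment, and it has a density with finite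
differential entropy (so that the entropy of the variational family makes sense). -/
structure StandardBase (ν : Measure ℝ) : Prop where
  isProb : IsProbabilityMeasure ν
  mean : ∫ x, x ∂ν = 0
  second : ∫ x, x ^ 2 ∂ν = 1
  third : ∫ x, x ^ 3 ∂ν = 0
  fourth : Integrable (fun x => x ^ 4) ν
  density : ν ≪ volume
  entropy : Integrable (fun x => Real.log (ν.rnDeriv volume x).toReal) ν

/-- The kurtosis `k_φ = E u_i⁴`. -/
def kurt (ν : Measure ℝ) : ℝ := ∫ x, x ^ 4 ∂ν

/-- The variational approximation `q_λ`: the law of `T_λ(u)`, `u ∼ φ`. -/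
def varDist (ν : Measure ℝ) (lam : Param d) : Measure (Vec d) :=
  (base d ν).map (reparam lam)

/-- The differential entropy `ℍ(q) = - E_{z ∼ q} log q(z)`, where `q(z)` is the Lebesgue density
of `q`. -/
def diffEntropy (q : Measure (Vec d)) : ℝ :=
  -∫ z, Real.log (q.rnDeriv volume z).toReal ∂q

/-- The negative evidence lower bound
`F(λ) = E_{z ∼ q_λ} (- log ℓ(z)) - ℍ(q_λ)`. -/
def negELBO (ν : Measure ℝ) (ℓ : Vec d → ℝ) (lam : Param d) : ℝ :=
  (∫ z, -Real.log (ℓ z) ∂(varDist ν lam)) - diffEntropy (varDist ν lam)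

/-- The closed-form entropy gradient estimator of `∇ F(λ)` from one base sample `u`:
`g(λ; u) = - ∇_λ log ℓ(T_λ(u)) - ∇_λ ℍ(q_λ)`. -/
def cfe (ν : Measure ℝ) (ℓ : Vec d → ℝ) (lam : Param d) (u : Fin d → ℝ) : Param d :=
  -gradient (fun l : Param d => Real.log (ℓ (reparam l u))) lam
    - gradient (fun l : Param d => diffEntropy (varDist ν l)) lam

/-- The domain `Λ_S`: `C` is lower triangular with smallest eigenvalue at least `1 / √S`. The
eigenvalues of a triangular matrix are its diagonal entries (see `mem_domain_iff`). -/
def domain (d : ℕ) (S : ℝ) : Set (Param d) :=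
  {lam | ∀ i, 1 / Real.sqrt S ≤ scale lam i i}

theorem mem_domain_iff (S : ℝ) (lam : Param d) :
    lam ∈ domain d S ↔
      ∀ x : ℝ, Module.End.HasEigenvalue (Matrix.toLin' (scale lam)) x → 1 / Real.sqrt S ≤ x := by
  have key : ∀ x : ℝ, Module.End.HasEigenvalue (Matrix.toLin' (scale lam)) x ↔
      ∃ i, x = scale lam i i := by
    intro x
    have hlt : ((scale lam).transpose).BlockTriangular id := by
      intro i j hij
      simp only [id] at hij
      simp [scale, not_le.mpr hij]
    rw [Module.End.hasEigenvalue_iff_isRoot_charpoly, Matrix.charpoly_toLin',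
      ← Matrix.charpoly_transpose, Matrix.charpoly_of_isUpperTriangular _ hlt,
      Polynomial.IsRoot.def, Polynomial.eval_prod, Finset.prod_eq_zero_iff]
    simp [sub_eq_zero]
  constructor
  · intro h x hx
    obtain ⟨i, rfl⟩ := (key x).1 hx
    exact h i
  · intro h i
    exact h _ ((key _).2 ⟨i, rfl⟩)

/-- The projection onto `Λ_S`: it replaces `C_ii` by `max(C_ii, 1/√S)`. It is the Euclidean
projection, by `proj_mem` and `norm_sub_proj_le`. -/
def proj (S : ℝ) (lam : Param d) : Param d :=
  WithLp.toLp 2 (Sum.elim (fun i => lam (Sum.inl i)) (fun p =>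
    if p.1.1 = p.1.2 then max (lam (Sum.inr p)) (1 / Real.sqrt S) else lam (Sum.inr p)))

theorem proj_mem (S : ℝ) (lam : Param d) : proj S lam ∈ domain d S := by
  intro i
  simp [proj, scale]

theorem norm_sub_proj_le (S : ℝ) (lam lam' : Param d) (h : lam' ∈ domain d S) :
    ‖lam - proj S lam‖ ≤ ‖lam - lam'‖ := by
  refine le_of_sq_le_sq ?_ (norm_nonneg _)
  rw [EuclideanSpace.real_norm_sq_eq, EuclideanSpace.real_norm_sq_eq]
  refine Finset.sum_le_sum fun x _ => ?_
  rcases x with i | ⟨⟨i, j⟩, hij⟩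
  · simp [proj, sq_nonneg]
  · by_cases e : i = j
    · subst e
      have h1 : 1 / Real.sqrt S ≤ lam' (Sum.inr ⟨(i, i), hij⟩) := by
        simpa [scale] using h i
      simp only [proj, PiLp.sub_apply, Sum.elim_inr, if_true]
      rcases le_total (lam (Sum.inr ⟨(i, i), hij⟩)) (1 / Real.sqrt S) with h2 | h2
      · rw [max_eq_right h2]
        nlinarith
      · rw [max_eq_left h2]
        nlinarith [sq_nonneg (lam (Sum.inr ⟨(i, i), hij⟩) - lam' (Sum.inr ⟨(i, i), hij⟩))]
    · simp [proj, e, sq_nonneg]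

/-- Projected SGD on `Λ_S` with the closed-form entropy estimator, fixed stepsize `γ`, starting
point `lam0` and base samples `u 0, u 1, …`:
`λ_{t+1} = proj_{Λ_S} (λ_t - γ g(λ_t; u_t))`. -/
def sgd (ν : Measure ℝ) (ℓ : Vec d → ℝ) (S γ : ℝ) (lam0 : Param d) (u : ℕ → Fin d → ℝ) :
    ℕ → Param d
  | 0 => lam0
  | t + 1 => proj S (sgd ν ℓ S γ lam0 u t - γ • cfe ν ℓ (sgd ν ℓ S γ lam0 u t) (u t))

/-- `L`-log-smoothness of an (unnormalized) density. -/
def LogSmooth (L : ℝ) (ℓ : Vec d → ℝ) : Prop :=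
  Differentiable ℝ (fun z => Real.log (ℓ z)) ∧
    ∀ z z' : Vec d,
      ‖gradient (fun y => Real.log (ℓ y)) z - gradient (fun y => Real.log (ℓ y)) z'‖
        ≤ L * ‖z - z'‖

/-- `μ`-strong log-concavity of a (differentiable, unnormalized) density: `- log ℓ` is
`μ`-strongly convex. -/
def StronglyLogConcave (μ : ℝ) (ℓ : Vec d → ℝ) : Prop :=
  ∀ z z' : Vec d,
    inner ℝ (gradient (fun y => -Real.log (ℓ y)) z) (z - z')
      ≥ -Real.log (ℓ z) - -Real.log (ℓ z') + μ / 2 * ‖z - z'‖ ^ 2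

end

end BBVI

/-! The map `λ ↦ T_λ(u)` is linear for fixed `u`, and since the components of `u` are centered with
unit variance and uncorrelated, `E‖T_λ(u)‖² = ‖λ‖²`: it is an isometry of the parameters into
`L²(φ)`. The `μ`-strong convexity of `-log ℓ` therefore passes to the energy with the same `μ`. The
entropy is a constant plus `∑ log C_ii`, which is concave, so the mean of the estimator is a
strongly convex subgradient of `F` (`integral_inner_stepDir_ge`). With quadratic growth at the
constrained minimizer (`negELBO_growth`) this gives `E⟨g, λ - λ*⟩ ≥ μ‖λ - λ*‖²`.

The noise is measured from `λ̄ = (z̄, 0)`. As `T_λ̄(u) = z̄` for every `u`, smoothness bounds the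
gradient at `T_λ(u)` by `L‖T_{λ-λ̄}(u)‖`; fourth moments of `u` and the bound `1/C_ii ≤ L C_ii` on
the domain then give `E‖g‖² ≤ L²(d + k_φ + 4)‖λ - λ̄‖²` (`norm_stepDir_sq_moment`).

The projection does not increase the distance to `λ*`, so with `A = 2L²(d + k_φ + 4)` and `γA ≤ μ`
one step contracts the mean squared distance by `1 - γμ`, up to an error `γ²A‖λ̄ - λ*‖²`
(`norm_sgdStep_sub_sq_moment`). Independence of `u_t` from `λ_t` lets this be iterated. The stepsize
keeps the accumulated error below `ε/2`, and the number of steps brings the initial term below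
`ε/2`. -/

namespace BBVI

/-! ### Density of the base distribution and entropy of `q_λ` -/

/-- A product of functions of the single coordinates integrates to the product of the integrals. -/
theorem lintegral_pi_prod {ι X : Type*} [Fintype ι] [MeasurableSpace X] (μ : ι → Measure X)
    [∀ i, SigmaFinite (μ i)] (f : ι → X → ENNReal) (hf : ∀ i, Measurable (f i))
    (hfin : ∀ i, ∫⁻ x, f i x ∂(μ i) ≠ ⊤) :
    ∫⁻ x, ∏ i, f i (x i) ∂(Measure.pi μ) = ∏ i, ∫⁻ x, f i x ∂(μ i) := by
  -- A finite integral makes each factor finite almost everywhere, so the real-valued product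
  -- formula applies to the `toReal` parts.
  have hint : ∀ i, Integrable (fun x => (f i x).toReal) (μ i) := fun i =>
    integrable_toReal_of_lintegral_ne_top (hf i).aemeasurable (hfin i)
  have hae : ∀ i, ∀ᵐ x ∂(μ i), ENNReal.ofReal (f i x).toReal = f i x := fun i => by
    filter_upwards [ae_lt_top (hf i) (hfin i)] with x hx
    exact ENNReal.ofReal_toReal hx.ne
  have hpi : ∀ᵐ x ∂(Measure.pi μ), ∀ i, ENNReal.ofReal (f i (x i)).toReal = f i (x i) :=
    ae_all_iff.2 fun i => (Measure.quasiMeasurePreserving_eval (μ := μ) i).ae (hae i)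
  calc ∫⁻ x, ∏ i, f i (x i) ∂(Measure.pi μ)
      = ∫⁻ x, ENNReal.ofReal (∏ i, (f i (x i)).toReal) ∂(Measure.pi μ) := by
        refine lintegral_congr_ae ?_
        filter_upwards [hpi] with x hx
        rw [ENNReal.ofReal_prod_of_nonneg fun i _ => ENNReal.toReal_nonneg]
        exact Finset.prod_congr rfl fun i _ => (hx i).symm
    _ = ENNReal.ofReal (∏ i, ∫ x, (f i x).toReal ∂(μ i)) := by
        rw [← ofReal_integral_eq_lintegral_ofReal
          (Integrable.fintype_prod (f := fun i x => (f i x).toReal) hint)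
          (Filter.Eventually.of_forall fun x =>
            Finset.prod_nonneg fun i _ => ENNReal.toReal_nonneg),
          integral_fintype_prod_eq_prod (fun i x => (f i x).toReal)]
    _ = ∏ i, ∫⁻ x, f i x ∂(μ i) := by
        rw [ENNReal.ofReal_prod_of_nonneg fun i _ =>
          integral_nonneg fun x => ENNReal.toReal_nonneg]
        refine Finset.prod_congr rfl fun i _ => ?_
        rw [ofReal_integral_eq_lintegral_ofReal (hint i)
          (Filter.Eventually.of_forall fun x => ENNReal.toReal_nonneg)]
        exact lintegral_congr_ae (hae i)

theorem base_eq_withDensity (d : ℕ) (ν : Measure ℝ) [IsProbabilityMeasure ν] (hν : ν ≪ volume) :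
    base d ν = volume.withDensity (fun x => ∏ i, ν.rnDeriv volume (x i)) := by
  refine Measure.pi_eq fun s hs => ?_
  rw [withDensity_apply _ (MeasurableSet.univ_pi hs), volume_pi, Measure.restrict_pi_pi,
    lintegral_pi_prod _ (fun _ => ν.rnDeriv volume) (fun _ => Measure.measurable_rnDeriv _ _)]
  · exact Finset.prod_congr rfl fun i _ => Measure.setLIntegral_rnDeriv hν _
  · intro i
    rw [Measure.setLIntegral_rnDeriv hν]
    exact measure_ne_top _ _

variable {d : ℕ}

instance (d : ℕ) (ν : Measure ℝ) [IsProbabilityMeasure ν] : IsProbabilityMeasure (base d ν) := by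
  unfold base; infer_instance

theorem base_absolutelyContinuous (ν : Measure ℝ) [IsProbabilityMeasure ν] (hν : ν ≪ volume) :
    base d ν ≪ volume := by
  rw [base_eq_withDensity d ν hν]
  exact withDensity_absolutelyContinuous _ _

/-- The joint density is the product of the marginal densities, which are almost surely neither zero
nor infinite, so its logarithm is a sum of integrable one-coordinate terms. The integrability is
needed to split the entropy integral of `q_λ`. -/
theorem integrable_log_rnDeriv_base {ν : Measure ℝ} (hν : StandardBase ν) :
    Integrable (fun x => Real.log ((base d ν).rnDeriv volume x).toReal) (base d ν) := by
  have := hν.isProb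
  have hac := base_absolutelyContinuous (d := d) ν hν.density
  have h1 : (base d ν).rnDeriv volume =ᵐ[base d ν] fun x => ∏ i, ν.rnDeriv volume (x i) := by
    apply hac.ae_eq
    conv_lhs => rw [base_eq_withDensity d ν hν.density]
    exact Measure.rnDeriv_withDensity _ (Finset.measurable_prod _ fun i _ =>
      (Measure.measurable_rnDeriv _ _).comp (measurable_pi_apply i))
  have h2 : ∀ᵐ x ∂(base d ν), ∀ i, ν.rnDeriv volume (x i) ≠ 0 ∧ ν.rnDeriv volume (x i) ≠ ⊤ := by
    refine ae_all_iff.2 fun i => ?_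
    refine (Measure.quasiMeasurePreserving_eval (fun _ : Fin d => ν) i).ae
      (p := fun y => ν.rnDeriv volume y ≠ 0 ∧ ν.rnDeriv volume y ≠ ⊤) ?_
    filter_upwards [Measure.rnDeriv_pos hν.density,
      hν.density.ae_le (Measure.rnDeriv_lt_top ν volume)] with x hx hx'
    exact ⟨hx.ne', hx'.ne⟩
  have h3 : Integrable (fun x : Fin d → ℝ => ∑ i, Real.log (ν.rnDeriv volume (x i)).toReal)
      (base d ν) :=
    integrable_finsetSum _ fun i _ => integrable_comp_eval (μ := fun _ : Fin d => ν) hν.entropy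
  refine h3.congr ?_
  filter_upwards [h1, h2] with x hx hx'
  rw [hx, ENNReal.toReal_prod, Real.log_prod]
  exact fun i _ => (ENNReal.toReal_pos (hx' i).1 (hx' i).2).ne'

theorem det_scale (lam : Param d) : (scale lam).det = ∏ i, scale lam i i := by
  refine Matrix.det_of_isLowerTriangular _ ?_
  intro i j hij
  have : i < j := hij
  simp [scale, not_le.mpr this]

theorem continuous_reparam (lam : Param d) : Continuous (reparam lam) := by
  unfold reparam
  refine (PiLp.continuous_toLp 2 _).comp ?_
  exact (Continuous.matrix_mulVec continuous_const continuous_id).add continuous_const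

theorem measurableEmbedding_reparam {lam : Param d} (h : (scale lam).det ≠ 0) :
    MeasurableEmbedding (reparam lam) := by
  refine (continuous_reparam lam).measurableEmbedding fun u v huv => ?_
  have h1 : (scale lam).mulVec u = (scale lam).mulVec v := by
    have := congrArg (WithLp.ofLp) huv
    simpa [reparam] using this
  exact Matrix.mulVec_injective_iff_isUnit.2 ((Matrix.isUnit_iff_isUnit_det _).2 h.isUnit) h1

theorem map_reparam_volume {lam : Param d} (h : (scale lam).det ≠ 0) :
    (volume : Measure (Fin d → ℝ)).map (reparam lam)
      = ENNReal.ofReal |(scale lam).det⁻¹| • volume := by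
  have e : reparam lam = WithLp.toLp 2 ∘ (fun x => x + loc lam) ∘ Matrix.toLin' (scale lam) := by
    ext u; simp [reparam]
  have m1 : Measurable (Matrix.toLin' (scale lam)) :=
    (LinearMap.continuous_of_finiteDimensional _).measurable
  rw [e, ← Measure.map_map (PiLp.volume_preserving_toLp (Fin d)).measurable
      ((measurable_add_const _).comp m1), ← Measure.map_map (measurable_add_const _) m1,
    Real.map_matrix_volume_pi_eq_smul_volume_pi h, Measure.map_smul, Measure.map_smul,
    (measurePreserving_add_right volume (loc lam)).map_eq,
    (PiLp.volume_preserving_toLp (Fin d)).map_eq]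

/-- The differential entropy of a location-scale family. -/
theorem diffEntropy_varDist {ν : Measure ℝ} (hν : StandardBase ν) {lam : Param d}
    (h : ∀ i, 0 < scale lam i i) :
    diffEntropy (varDist ν lam)
      = -∫ x, Real.log ((base d ν).rnDeriv volume x).toReal ∂(base d ν)
        + ∑ i, Real.log (scale lam i i) := by
  have := hν.isProb
  have hac := base_absolutelyContinuous (d := d) ν hν.density
  have hdet : 0 < (scale lam).det := by
    rw [det_scale]; exact Finset.prod_pos fun i _ => h i
  have hemb := measurableEmbedding_reparam hdet.ne'
  have hc0 : ENNReal.ofReal |(scale lam).det⁻¹| ≠ 0 := by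
    simp [hdet.ne']
  have : IsProbabilityMeasure (varDist ν lam) :=
    Measure.isProbabilityMeasure_map hemb.measurable.aemeasurable
  have h1 := (hemb.rnDeriv_map (base d ν) volume)
  -- Change of variables: Lebesgue measure is pushed to `|det C|⁻¹` times Lebesgue measure, so
  -- densities with respect to the two references differ by this constant.
  have h2 : ∀ᵐ x ∂(volume : Measure (Fin d → ℝ)),
      ((base d ν).map (reparam lam)).rnDeriv (volume.map (reparam lam)) (reparam lam x)
        = (ENNReal.ofReal |(scale lam).det⁻¹|)⁻¹
          * (varDist ν lam).rnDeriv volume (reparam lam x) := by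
    have h3 := Measure.rnDeriv_smul_right_of_ne_top (varDist ν lam) volume hc0 ENNReal.ofReal_ne_top
    rw [← map_reparam_volume hdet.ne'] at h3
    have h4 : (varDist ν lam).rnDeriv (volume.map (reparam lam))
        =ᵐ[volume.map (reparam lam)] (ENNReal.ofReal |(scale lam).det⁻¹|)⁻¹
          • (varDist ν lam).rnDeriv volume := by
      refine Measure.AbsolutelyContinuous.ae_eq ?_ h3
      rw [map_reparam_volume hdet.ne']
      exact Measure.smul_absolutelyContinuous
    exact ae_of_ae_map hemb.measurable.aemeasurable h4
  have h5 : ∀ᵐ x ∂(base d ν), Real.log ((varDist ν lam).rnDeriv volume (reparam lam x)).toReal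
      = Real.log ((base d ν).rnDeriv volume x).toReal - Real.log (scale lam).det := by
    filter_upwards [hac.ae_le h1, hac.ae_le h2, Measure.rnDeriv_pos hac,
      hac.ae_le (Measure.rnDeriv_lt_top (base d ν) volume)] with x hx1 hx2 hx3 hx4
    have hx5 : ((base d ν).rnDeriv volume x).toReal
        = (scale lam).det * ((varDist ν lam).rnDeriv volume (reparam lam x)).toReal := by
      rw [← hx1, hx2, ENNReal.toReal_mul, ENNReal.toReal_inv,
        ENNReal.toReal_ofReal (abs_nonneg _), abs_inv, inv_inv, abs_of_pos hdet]
    have hx6 := ENNReal.toReal_pos hx3.ne' hx4.ne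
    have hx7 : ((varDist ν lam).rnDeriv volume (reparam lam x)).toReal ≠ 0 := by
      intro h0; rw [hx5, h0, mul_zero] at hx6; exact lt_irrefl _ hx6
    rw [hx5, Real.log_mul hdet.ne' hx7]; ring
  have h6 : ∫ z, Real.log ((varDist ν lam).rnDeriv volume z).toReal ∂(varDist ν lam)
      = ∫ x, Real.log ((varDist ν lam).rnDeriv volume (reparam lam x)).toReal ∂(base d ν) :=
    hemb.integral_map _
  rw [diffEntropy, h6, integral_congr_ae h5,
    integral_sub (integrable_log_rnDeriv_base hν) (integrable_const _), integral_const,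
    det_scale, Real.log_prod fun i _ => (h i).ne']
  simp
  ring

/-! ### Moments of the base distribution and of the reparameterization -/

variable {ν : Measure ℝ}

/-- Dominated by `1 + x⁴`. -/
theorem StandardBase.integrable_pow (hν : StandardBase ν) {n : ℕ} (hn : n ≤ 4) :
    Integrable (fun x : ℝ => x ^ n) ν := by
  have := hν.isProb
  refine Integrable.mono' ((integrable_const (1 : ℝ)).add hν.fourth)
    (by fun_prop) (Filter.Eventually.of_forall fun x => ?_)
  rw [Real.norm_eq_abs, abs_pow, Pi.add_apply, ← Even.pow_abs (by decide : Even 4)]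
  rcases le_total |x| 1 with h | h
  · have := pow_le_one₀ (n := n) (abs_nonneg x) h
    have := pow_nonneg (abs_nonneg x) 4
    linarith
  · have := pow_le_pow_right₀ h hn
    linarith

/-- This is `E(x² - 1)² ≥ 0`. -/
theorem StandardBase.one_le_kurt (hν : StandardBase ν) : 1 ≤ kurt ν := by
  have := hν.isProb
  have h2 := hν.integrable_pow (n := 2) (by norm_num)
  have h : 0 ≤ ∫ x, (x ^ 4 - 2 * x ^ 2 + 1) ∂ν :=
    integral_nonneg fun x => by
      have : x ^ 4 - 2 * x ^ 2 + 1 = (x ^ 2 - 1) ^ 2 := by ring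
      simp only [Pi.zero_apply, this]; positivity
  have h3 : Integrable (fun x : ℝ => x ^ 4 - 2 * x ^ 2) ν := hν.fourth.sub (h2.const_mul 2)
  rw [integral_add h3 (integrable_const _),
    integral_sub hν.fourth (h2.const_mul 2), integral_const_mul, hν.second] at h
  simp at h
  unfold kurt; linarith

/-- The exponents of the monomial `u_j ^ a * u_k ^ b * u_l ^ c`. -/
def expo (j k l : Fin d) (a b c : ℕ) (i : Fin d) : ℕ :=
  (if i = j then a else 0) + (if i = k then b else 0) + (if i = l then c else 0)

theorem prod_pow_expo (u : Fin d → ℝ) (j k l : Fin d) (a b c : ℕ) :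
    ∏ i, u i ^ expo j k l a b c i = u j ^ a * u k ^ b * u l ^ c := by
  simp_rw [expo, pow_add, Finset.prod_mul_distrib, pow_ite, pow_zero, Finset.prod_ite_eq',
    Finset.mem_univ, if_true]

theorem expo_le (j k l : Fin d) (a b c : ℕ) (i : Fin d) : expo j k l a b c i ≤ a + b + c := by
  unfold expo; split_ifs <;> omega

theorem StandardBase.integrable_monomial (hν : StandardBase ν) (j k l : Fin d) {a b c : ℕ}
    (h : a + b + c ≤ 4) :
    Integrable (fun u : Fin d → ℝ => u j ^ a * u k ^ b * u l ^ c) (base d ν) := by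
  have := hν.isProb
  simp_rw [← prod_pow_expo]
  exact Integrable.fintype_prod (f := fun i x => x ^ expo j k l a b c i)
    fun i => hν.integrable_pow ((expo_le j k l a b c i).trans h)

theorem StandardBase.integral_monomial (hν : StandardBase ν) (j k l : Fin d) (a b c : ℕ) :
    ∫ u, u j ^ a * u k ^ b * u l ^ c ∂(base d ν)
      = ∏ i, ∫ x, x ^ expo j k l a b c i ∂ν := by
  have := hν.isProb
  simp_rw [← prod_pow_expo]
  exact integral_fintype_prod_eq_prod (fun i x => x ^ expo j k l a b c i)

theorem StandardBase.integral_monomial_eq_zero (hν : StandardBase ν) (j k l : Fin d) {a b c : ℕ}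
    (i : Fin d) (hi : expo j k l a b c i = 1 ∨ expo j k l a b c i = 3) :
    ∫ u, u j ^ a * u k ^ b * u l ^ c ∂(base d ν) = 0 := by
  rw [hν.integral_monomial]
  refine Finset.prod_eq_zero (Finset.mem_univ i) ?_
  rcases hi with hi | hi <;> rw [hi]
  · simpa using hν.mean
  · exact hν.third

/-- For `a = 2` and `k = j` this is the third moment; no other mixed moment used here needs zero
skewness. -/
theorem StandardBase.integral_mul_coord (hν : StandardBase ν) (j k : Fin d) {a : ℕ}
    (ha : a = 0 ∨ a = 2) :
    ∫ u, u j ^ a * u k ∂(base d ν) = 0 := by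
  have h := hν.integral_monomial_eq_zero j k k (a := a) (b := 1) (c := 0) k (by
    rcases ha with rfl | rfl <;> by_cases h : k = j <;> simp [expo, h])
  simpa using h

theorem StandardBase.integral_mul_coord_coord (hν : StandardBase ν) (j k l : Fin d) (hkl : k ≠ l)
    {a : ℕ} (ha : a = 0 ∨ a = 2) :
    ∫ u, u j ^ a * u k * u l ∂(base d ν) = 0 := by
  by_cases hk : k = j
  · have h := hν.integral_monomial_eq_zero j k l (a := a) (b := 1) (c := 1) l (by
      have : ¬ l = k := fun h => hkl h.symm
      have h2 : ¬ l = j := fun h => hkl (hk.trans h.symm)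
      rcases ha with rfl | rfl <;> simp [expo, this, h2])
    simpa using h
  · have h := hν.integral_monomial_eq_zero j k l (a := a) (b := 1) (c := 1) k (by
      rcases ha with rfl | rfl <;> simp [expo, hk, hkl])
    simpa using h

theorem StandardBase.integral_sq (hν : StandardBase ν) (j : Fin d) :
    ∫ u, u j ^ 2 ∂(base d ν) = 1 := by
  have := hν.isProb
  have h := hν.integral_monomial j j j 2 0 0
  simp only [pow_zero, mul_one] at h
  rw [h, Finset.prod_eq_one]
  intro i _
  by_cases hi : i = j <;> simp [expo, hi, hν.second]

theorem StandardBase.integral_sq_mul_sq (hν : StandardBase ν) (j k : Fin d) :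
    ∫ u, u j ^ 2 * u k * u k ∂(base d ν) = if k = j then kurt ν else 1 := by
  have := hν.isProb
  have h := hν.integral_monomial j k k 2 1 1
  simp only [pow_one] at h
  rw [h]
  split_ifs with hk
  · subst hk
    rw [Finset.prod_eq_single k]
    · simp [expo, kurt]
    · intro i _ hi; simp [expo, hi]
    · simp
  · refine Finset.prod_eq_one fun i _ => ?_
    by_cases hi : i = j
    · subst hi
      have : ¬ i = k := fun h => hk h.symm
      simp [expo, this, hν.second]
    · by_cases hi' : i = k
      · subst hi'; simp [expo, hi, hν.second]
      · simp [expo, hi, hi']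

/-- The second moment of an affine functional under a weight that keeps the coordinates centered
and uncorrelated. -/
theorem integral_weight_mul_affine_sq {ρ : Measure (Fin d → ℝ)} {w : (Fin d → ℝ) → ℝ}
    {s : Fin d → ℝ} (hw0 : Integrable w ρ) (hw1 : ∀ k, Integrable (fun u => w u * u k) ρ)
    (hw2 : ∀ k l, Integrable (fun u => w u * u k * u l) ρ) (i0 : ∫ u, w u ∂ρ = 1)
    (i1 : ∀ k, ∫ u, w u * u k ∂ρ = 0)
    (i2 : ∀ k l, k ≠ l → ∫ u, w u * u k * u l ∂ρ = 0)
    (i2' : ∀ k, ∫ u, w u * u k * u k ∂ρ = s k) (c : Fin d → ℝ) (m : ℝ) :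
    Integrable (fun u => w u * (∑ k, c k * u k + m) ^ 2) ρ ∧
      ∫ u, w u * (∑ k, c k * u k + m) ^ 2 ∂ρ = ∑ k, c k ^ 2 * s k + m ^ 2 := by
  have e : ∀ u, w u * (∑ k, c k * u k + m) ^ 2
      = ∑ k, ∑ l, c k * c l * (w u * u k * u l) + ∑ k, 2 * m * c k * (w u * u k)
        + m ^ 2 * w u := by
    intro u
    have h1 : ∑ k, ∑ l, c k * c l * (w u * u k * u l)
        = w u * ((∑ k, c k * u k) * ∑ k, c k * u k) := by
      rw [Finset.sum_mul_sum, Finset.mul_sum]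
      refine Finset.sum_congr rfl fun k _ => ?_
      rw [Finset.mul_sum]
      exact Finset.sum_congr rfl fun l _ => by ring
    have h2 : ∑ k, 2 * m * c k * (w u * u k) = 2 * m * w u * ∑ k, c k * u k := by
      rw [Finset.mul_sum]
      exact Finset.sum_congr rfl fun k _ => by ring
    rw [h1, h2]; ring
  simp_rw [e]
  have j1 : Integrable (fun u => ∑ k, ∑ l, c k * c l * (w u * u k * u l)) ρ :=
    integrable_finsetSum _ fun k _ => integrable_finsetSum _ fun l _ => (hw2 k l).const_mul _
  have j2 : Integrable (fun u => ∑ k, 2 * m * c k * (w u * u k)) ρ :=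
    integrable_finsetSum _ fun k _ => (hw1 k).const_mul _
  have j3 : Integrable (fun u => ∑ k, ∑ l, c k * c l * (w u * u k * u l)
      + ∑ k, 2 * m * c k * (w u * u k)) ρ := j1.add j2
  refine ⟨j3.add (hw0.const_mul _), ?_⟩
  rw [integral_add j3 (hw0.const_mul _), integral_add j1 j2,
    integral_finsetSum _ (fun k _ => integrable_finsetSum _ fun l _ => (hw2 k l).const_mul _),
    integral_finsetSum _ (fun k _ => (hw1 k).const_mul _), integral_const_mul, i0]
  simp_rw [integral_const_mul, i1]
  simp only [mul_zero, Finset.sum_const_zero, add_zero, mul_one]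
  congr 1
  refine Finset.sum_congr rfl fun k _ => ?_
  rw [integral_finsetSum _ fun l _ => (hw2 k l).const_mul _, Finset.sum_eq_single k]
  · rw [integral_const_mul, i2']; ring
  · intro l _ hl
    rw [integral_const_mul, i2 k l hl.symm, mul_zero]
  · simp

theorem reparam_apply (lam : Param d) (u : Fin d → ℝ) (i : Fin d) :
    reparam lam u i = ∑ k, scale lam i k * u k + loc lam i := by
  simp [reparam, Matrix.mulVec, dotProduct]

theorem norm_reparam_sq (lam : Param d) (u : Fin d → ℝ) :
    ‖reparam lam u‖ ^ 2 = ∑ i, (∑ k, scale lam i k * u k + loc lam i) ^ 2 := by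
  rw [EuclideanSpace.real_norm_sq_eq]
  simp_rw [reparam_apply]

/-- The covariance of `u` is the identity, so each row of `C` contributes its squared norm and the
cross terms with `m` vanish. -/
theorem StandardBase.norm_reparam_sq_moment (hν : StandardBase ν) (lam : Param d) :
    Integrable (fun u => ‖reparam lam u‖ ^ 2) (base d ν) ∧
      ∫ u, ‖reparam lam u‖ ^ 2 ∂(base d ν) = ‖lam‖ ^ 2 := by
  have := hν.isProb
  have h := fun i => integral_weight_mul_affine_sq (ρ := base d ν) (w := fun _ => 1)
    (s := fun _ => 1) (integrable_const _)
    (fun k => by simpa using hν.integrable_monomial k k k (a := 1) (b := 0) (c := 0) (by norm_num))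
    (fun k l => by
      simpa using hν.integrable_monomial k l l (a := 1) (b := 1) (c := 0) (by norm_num))
    (by simp) (fun k => by simpa using hν.integral_mul_coord k k (a := 0) (by simp))
    (fun k l hkl => by simpa using hν.integral_mul_coord_coord k k l hkl (a := 0) (by simp))
    (fun k => by simpa [pow_two] using hν.integral_sq k) (scale lam i) (loc lam i)
  simp only [one_mul, mul_one] at h
  simp_rw [norm_reparam_sq]
  refine ⟨integrable_finsetSum _ fun i _ => (h i).1, ?_⟩
  rw [integral_finsetSum _ fun i _ => (h i).1, norm_sq_eq, ← Finset.sum_add_distrib]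
  exact Finset.sum_congr rfl fun i _ => by rw [(h i).2]; ring

/-- Under the weight `u_j²` the coordinates stay centered and uncorrelated; the `j`-th has second
moment `k_φ` and the others `1`. Summed over `j`, each `C_ik²` gets the factor `d - 1 + k_φ` and
each `m_i²` the factor `d`, which is no larger because `k_φ ≥ 1`. -/
theorem StandardBase.sum_sq_mul_norm_reparam_sq_moment (hν : StandardBase ν) (lam : Param d) :
    Integrable (fun u => (∑ j, u j ^ 2) * ‖reparam lam u‖ ^ 2) (base d ν) ∧
      ∫ u, (∑ j, u j ^ 2) * ‖reparam lam u‖ ^ 2 ∂(base d ν)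
        ≤ (d - 1 + kurt ν) * ‖lam‖ ^ 2 := by
  have := hν.isProb
  have h := fun i j => integral_weight_mul_affine_sq (ρ := base d ν) (w := fun u => u j ^ 2)
    (s := fun k => if k = j then kurt ν else 1)
    (by simpa using hν.integrable_monomial j j j (a := 2) (b := 0) (c := 0) (by norm_num))
    (fun k => by simpa using hν.integrable_monomial j k k (a := 2) (b := 1) (c := 0) (by norm_num))
    (fun k l => by
      simpa using hν.integrable_monomial j k l (a := 2) (b := 1) (c := 1) (by norm_num))
    (hν.integral_sq j) (fun k => hν.integral_mul_coord j k (by simp))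
    (fun k l hkl => hν.integral_mul_coord_coord j k l hkl (by simp))
    (fun k => hν.integral_sq_mul_sq j k) (scale lam i) (loc lam i)
  simp_rw [norm_reparam_sq, Finset.sum_mul, Finset.mul_sum]
  refine ⟨integrable_finsetSum _ fun j _ => integrable_finsetSum _ fun i _ => (h i j).1, ?_⟩
  rw [integral_finsetSum _ fun j _ => integrable_finsetSum _ fun i _ => (h i j).1]
  simp_rw [integral_finsetSum _ fun i _ => (h i _).1, (h _ _).2]
  rw [Finset.sum_comm, norm_sq_eq, ← Finset.sum_add_distrib, Finset.mul_sum]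
  refine Finset.sum_le_sum fun i _ => ?_
  have e : ∀ k : Fin d, ∑ j : Fin d, scale lam i k ^ 2 * (if k = j then kurt ν else 1)
      = (d - 1 + kurt ν) * scale lam i k ^ 2 := by
    intro k
    have : ∀ j : Fin d, (if k = j then kurt ν else 1) = (if k = j then kurt ν - 1 else 0) + 1 := by
      intro j; split_ifs <;> ring
    simp_rw [this, ← Finset.mul_sum, Finset.sum_add_distrib, Finset.sum_ite_eq]
    simp; ring
  rw [Finset.sum_add_distrib, Finset.sum_comm]
  simp_rw [e]
  rw [← Finset.mul_sum, Finset.sum_const, Finset.card_univ, Fintype.card_fin, nsmul_eq_mul]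
  nlinarith [hν.one_le_kurt, sq_nonneg (loc lam i)]

/-! ### Linearity in the parameters and the closed form of the estimator -/

theorem reparam_add (lam lam' : Param d) (u : Fin d → ℝ) :
    reparam (lam + lam') u = reparam lam u + reparam lam' u := by
  ext i
  simp only [reparam_apply, PiLp.add_apply]
  have : ∀ k, scale (lam + lam') i k = scale lam i k + scale lam' i k := by
    intro k; simp only [scale, Matrix.of_apply]; split_ifs <;> simp
  simp_rw [this, add_mul, Finset.sum_add_distrib, loc, PiLp.add_apply]
  ring

theorem reparam_smul (c : ℝ) (lam : Param d) (u : Fin d → ℝ) :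
    reparam (c • lam) u = c • reparam lam u := by
  ext i
  simp only [reparam_apply, PiLp.smul_apply, smul_eq_mul]
  have : ∀ k, scale (c • lam) i k = c * scale lam i k := by
    intro k; simp only [scale, Matrix.of_apply]; split_ifs <;> simp
  simp_rw [this, mul_add, Finset.mul_sum, loc, PiLp.smul_apply, smul_eq_mul, mul_assoc]

/-- The reparameterization is linear in the parameters. -/
noncomputable def reparamCLM (u : Fin d → ℝ) : Param d →L[ℝ] Vec d :=
  LinearMap.toContinuousLinearMap
    { toFun := fun lam => reparam lam u
      map_add' := fun a b => reparam_add a b u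
      map_smul' := fun c a => reparam_smul c a u }

theorem reparamCLM_apply (u : Fin d → ℝ) (lam : Param d) : reparamCLM u lam = reparam lam u := rfl

theorem reparam_sub (lam lam' : Param d) (u : Fin d → ℝ) :
    reparam (lam - lam') u = reparam lam u - reparam lam' u := (reparamCLM u).map_sub lam lam'

theorem reparam_pointParam (z : Vec d) (u : Fin d → ℝ) : reparam (pointParam z) u = z := by
  ext i
  simp [reparam_apply, pointParam, scale, loc]

/-- The adjoint of the reparameterization as a linear map of the parameters. -/
noncomputable def reparamAdj (u : Fin d → ℝ) (v : Vec d) : Param d :=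
  WithLp.toLp 2 (Sum.elim (fun i => v i) (fun p => v p.1.1 * u p.1.2))

theorem inner_param (a b : Param d) :
    inner ℝ a b = ∑ i, loc a i * loc b i + ∑ i, ∑ j, scale a i j * scale b i j := by
  rw [PiLp.inner_apply, Fintype.sum_sum_type]
  congr 1
  · exact Finset.sum_congr rfl fun i _ => by simp [loc, mul_comm]
  rw [← Fintype.sum_prod_type' (f := fun i j => scale a i j * scale b i j),
    ← Fintype.sum_subtype_add_sum_subtype (fun p : Fin d × Fin d => p.2 ≤ p.1)
      (fun p => scale a p.1 p.2 * scale b p.1 p.2)]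
  have h0 : ∑ p : {p : Fin d × Fin d // ¬ p.2 ≤ p.1},
      scale a p.1.1 p.1.2 * scale b p.1.1 p.1.2 = 0 :=
    Finset.sum_eq_zero fun p _ => by simp [scale, p.2]
  rw [h0, add_zero]
  refine Finset.sum_congr rfl fun p _ => ?_
  simp [scale, p.2, mul_comm]

theorem scale_reparamAdj_mul (u : Fin d → ℝ) (v : Vec d) (lam : Param d) (i j : Fin d) :
    scale (reparamAdj u v) i j * scale lam i j = v i * (scale lam i j * u j) := by
  by_cases h : j ≤ i
  · simp [scale, reparamAdj, h]; ring
  · simp [scale, h]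

theorem inner_reparamAdj (u : Fin d → ℝ) (v : Vec d) (lam : Param d) :
    inner ℝ (reparamAdj u v) lam = inner ℝ v (reparam lam u) := by
  rw [inner_param, PiLp.inner_apply, ← Finset.sum_add_distrib]
  refine Finset.sum_congr rfl fun i _ => ?_
  simp_rw [scale_reparamAdj_mul, ← Finset.mul_sum, reparam_apply]
  simp [loc, reparamAdj]
  ring

/-- The full outer product `v uᵀ` would give equality; dropping the entries above the diagonal only
decreases the norm. -/
theorem norm_reparamAdj_sq_le (u : Fin d → ℝ) (v : Vec d) :
    ‖reparamAdj u v‖ ^ 2 ≤ (1 + ∑ j, u j ^ 2) * ‖v‖ ^ 2 := by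
  rw [norm_sq_eq, EuclideanSpace.real_norm_sq_eq, Finset.mul_sum, ← Finset.sum_add_distrib]
  refine Finset.sum_le_sum fun i _ => ?_
  have h : ∑ j, scale (reparamAdj u v) i j ^ 2 ≤ ∑ j, u j ^ 2 * v i ^ 2 := by
    refine Finset.sum_le_sum fun j _ => ?_
    by_cases h : j ≤ i
    · simp [scale, reparamAdj, h, mul_pow, mul_comm]
    · simp [scale, h]; positivity
  rw [← Finset.sum_mul] at h
  have : loc (reparamAdj u v) i = v i := rfl
  rw [this]
  linarith

/-- The gradient of `∑ i, log C_ii`. -/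
noncomputable def logDetGrad (lam : Param d) : Param d :=
  WithLp.toLp 2 (Sum.elim (fun _ => 0)
    (fun p => if p.1.1 = p.1.2 then (lam (Sum.inr p))⁻¹ else 0))

theorem scale_diag (lam : Param d) (i : Fin d) :
    scale lam i i = lam (Sum.inr ⟨(i, i), le_rfl⟩) := by
  simp [scale]

theorem loc_logDetGrad (lam : Param d) (i : Fin d) : loc (logDetGrad lam) i = 0 := rfl

theorem scale_logDetGrad (lam : Param d) (i j : Fin d) :
    scale (logDetGrad lam) i j = if i = j then (scale lam i j)⁻¹ else 0 := by
  by_cases h : j ≤ i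
  · simp [scale, logDetGrad, h]
  · have : i ≠ j := fun e => h e.ge
    simp [scale, h, this]

theorem inner_logDetGrad (lam lam' : Param d) :
    inner ℝ (logDetGrad lam) lam' = ∑ i, (scale lam i i)⁻¹ * scale lam' i i := by
  rw [inner_param]
  simp [loc_logDetGrad, scale_logDetGrad]

theorem hasGradientAt_sum_log {lam : Param d} (h : ∀ i, 0 < scale lam i i) :
    HasGradientAt (fun l : Param d => ∑ i, Real.log (scale l i i)) (logDetGrad lam) lam := by
  rw [hasGradientAt_iff_hasFDerivAt]
  have h1 : ∀ i : Fin d, HasFDerivAt (fun l : Param d => Real.log (scale l i i))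
      ((scale lam i i)⁻¹ • (EuclideanSpace.proj (𝕜 := ℝ) (Sum.inr ⟨(i, i), le_rfl⟩) :
        Param d →L[ℝ] ℝ)) lam := by
    intro i
    have h2 : HasFDerivAt (fun l : Param d => scale l i i)
        (EuclideanSpace.proj (𝕜 := ℝ) (Sum.inr ⟨(i, i), le_rfl⟩) : Param d →L[ℝ] ℝ) lam := by
      simp_rw [scale_diag]
      exact (EuclideanSpace.proj (𝕜 := ℝ) (Sum.inr ⟨(i, i), le_rfl⟩) :
        Param d →L[ℝ] ℝ).hasFDerivAt
    exact h2.log (h i).ne'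
  refine (HasFDerivAt.fun_sum fun i _ => h1 i).congr_fderiv ?_
  ext δ
  simp [inner_logDetGrad, scale_diag]

/-- The gradient of the negative log-density. -/
noncomputable def potGrad (ℓ : Vec d → ℝ) (z : Vec d) : Vec d :=
  gradient (fun y => -Real.log (ℓ y)) z

theorem potGrad_eq (ℓ : Vec d → ℝ) (z : Vec d) :
    potGrad ℓ z = -gradient (fun y => Real.log (ℓ y)) z := by
  unfold potGrad gradient
  rw [fderiv_fun_neg, map_neg]

theorem LogSmooth.norm_potGrad_sub_le {L : ℝ} {ℓ : Vec d → ℝ} (h : LogSmooth L ℓ) (z z' : Vec d) :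
    ‖potGrad ℓ z - potGrad ℓ z'‖ ≤ L * ‖z - z'‖ := by
  rw [potGrad_eq, potGrad_eq, ← neg_sub', norm_neg]
  exact h.2 z z'

theorem LogSmooth.continuous_potGrad {L : ℝ} {ℓ : Vec d → ℝ} (h : LogSmooth L ℓ) :
    Continuous (potGrad ℓ) := by
  refine (LipschitzWith.of_dist_le_mul (K := L.toNNReal) fun z z' => ?_).continuous
  rw [dist_eq_norm, dist_eq_norm]
  refine (h.norm_potGrad_sub_le z z').trans ?_
  gcongr
  exact Real.le_coe_toNNReal L

/-- The closed form of the estimator on parameters with positive diagonal. -/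
noncomputable def stepDir (ℓ : Vec d → ℝ) (lam : Param d) (u : Fin d → ℝ) : Param d :=
  reparamAdj u (potGrad ℓ (reparam lam u)) - logDetGrad lam

theorem gradient_reparam {L : ℝ} {ℓ : Vec d → ℝ} (h : LogSmooth L ℓ) (lam : Param d)
    (u : Fin d → ℝ) :
    gradient (fun l : Param d => Real.log (ℓ (reparam l u))) lam
      = -reparamAdj u (potGrad ℓ (reparam lam u)) := by
  refine HasGradientAt.gradient ?_
  rw [hasGradientAt_iff_hasFDerivAt]
  have h1 : HasFDerivAt (fun z => Real.log (ℓ z)) _ (reparamCLM u lam) :=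
    (h.1 (reparamCLM u lam)).hasGradientAt.hasFDerivAt
  refine (h1.comp lam (reparamCLM u).hasFDerivAt).congr_fderiv ?_
  ext δ
  simp only [ContinuousLinearMap.comp_apply, InnerProductSpace.toDual_apply_apply, inner_neg_left,
    inner_reparamAdj, potGrad_eq, neg_neg, reparamCLM_apply]

/-- The entropy formula requires a positive diagonal. This is an open condition, so the formula
holds near `lam` and may be differentiated. -/
theorem gradient_diffEntropy (hν : StandardBase ν) {lam : Param d} (h : ∀ i, 0 < scale lam i i) :
    gradient (fun l : Param d => diffEntropy (varDist ν l)) lam = logDetGrad lam := by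
  have h1 : ∀ᶠ l : Param d in nhds lam, ∀ i, 0 < scale l i i := by
    refine Filter.eventually_all.2 fun i => ?_
    have hc : Continuous fun l : Param d => scale l i i := by
      simp_rw [scale_diag]
      exact (EuclideanSpace.proj (𝕜 := ℝ) (Sum.inr ⟨(i, i), le_rfl⟩) :
        Param d →L[ℝ] ℝ).continuous
    exact hc.continuousAt.eventually (lt_mem_nhds (h i))
  have h2 : (fun l : Param d => diffEntropy (varDist ν l)) =ᶠ[nhds lam]
      fun l => -∫ x, Real.log ((base d ν).rnDeriv volume x).toReal ∂(base d ν)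
        + ∑ i, Real.log (scale l i i) := by
    filter_upwards [h1] with l hl
    exact diffEntropy_varDist hν hl
  rw [h2.gradient_eq]
  refine HasGradientAt.gradient ?_
  have h3 := hasGradientAt_sum_log h
  rw [hasGradientAt_iff_hasFDerivAt] at h3 ⊢
  exact h3.const_add _

theorem cfe_eq_stepDir (hν : StandardBase ν) {L : ℝ} {ℓ : Vec d → ℝ} (h : LogSmooth L ℓ)
    {lam : Param d} (hlam : ∀ i, 0 < scale lam i i) (u : Fin d → ℝ) :
    cfe ν ℓ lam u = stepDir ℓ lam u := by
  rw [cfe, gradient_reparam h, gradient_diffEntropy hν hlam, neg_neg, stepDir]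

/-! ### Joint measurability of the estimator -/

theorem continuous_uncurry_reparam :
    Continuous fun p : Param d × (Fin d → ℝ) => reparam p.1 p.2 := by
  refine (PiLp.continuous_toLp 2 _).comp (continuous_pi fun i => ?_)
  simp only [Pi.add_apply, Matrix.mulVec, dotProduct, scale, loc, Matrix.of_apply]
  refine Continuous.add (continuous_finsetSum _ fun j _ => ?_) (by fun_prop)
  split_ifs <;> fun_prop

theorem continuous_uncurry_reparamAdj :
    Continuous fun p : (Fin d → ℝ) × Vec d => reparamAdj p.1 p.2 := by
  refine (PiLp.continuous_toLp 2 _).comp (continuous_pi fun i => ?_)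
  rcases i with i | p <;> simp only [Sum.elim_inl, Sum.elim_inr] <;> fun_prop

theorem measurable_logDetGrad : Measurable (logDetGrad : Param d → Param d) := by
  refine (PiLp.continuous_toLp 2 _).measurable.comp (measurable_pi_lambda _ fun i => ?_)
  rcases i with i | p <;> simp only [Sum.elim_inl, Sum.elim_inr]
  · fun_prop
  · split_ifs <;> fun_prop

theorem measurable_uncurry_stepDir {L : ℝ} {ℓ : Vec d → ℝ} (h : LogSmooth L ℓ) :
    Measurable fun p : Param d × (Fin d → ℝ) => stepDir ℓ p.1 p.2 := by
  have h1 : Continuous fun p : Param d × (Fin d → ℝ) =>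
      reparamAdj p.2 (potGrad ℓ (reparam p.1 p.2)) :=
    continuous_uncurry_reparamAdj.comp
      (continuous_snd.prodMk (h.continuous_potGrad.comp continuous_uncurry_reparam))
  exact h1.measurable.sub (measurable_logDetGrad.comp measurable_fst)

/-! ### Integrability and strong convexity of the negative ELBO -/

theorem reparam_sub_point (lam : Param d) (z : Vec d) (u : Fin d → ℝ) :
    reparam (lam - pointParam z) u = reparam lam u - z := by
  rw [reparam_sub, reparam_pointParam]

theorem LogSmooth.norm_potGrad_reparam_le {L : ℝ} {ℓ : Vec d → ℝ} (h : LogSmooth L ℓ) {zbar : Vec d}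
    (hz : potGrad ℓ zbar = 0) (lam : Param d) (u : Fin d → ℝ) :
    ‖potGrad ℓ (reparam lam u)‖ ≤ L * ‖reparam (lam - pointParam zbar) u‖ := by
  have := h.norm_potGrad_sub_le (reparam lam u) zbar
  rwa [hz, sub_zero, ← reparam_sub_point] at this

theorem StandardBase.integrable_norm_mul_norm (hν : StandardBase ν) (lam lam' : Param d) :
    Integrable (fun u => ‖reparam lam u‖ * ‖reparam lam' u‖) (base d ν) := by
  refine Integrable.mono' ((hν.norm_reparam_sq_moment lam).1.add
    (hν.norm_reparam_sq_moment lam').1)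
    ((continuous_reparam lam).norm.mul (continuous_reparam lam').norm).aestronglyMeasurable
    (Filter.Eventually.of_forall fun u => ?_)
  rw [Real.norm_of_nonneg (by positivity), Pi.add_apply]
  nlinarith [sq_nonneg (‖reparam lam u‖ - ‖reparam lam' u‖), sq_nonneg ‖reparam lam u‖,
    sq_nonneg ‖reparam lam' u‖]

theorem integrable_inner_potGrad (hν : StandardBase ν) {L : ℝ} {ℓ : Vec d → ℝ}
    (h : LogSmooth L ℓ) {zbar : Vec d} (hz : potGrad ℓ zbar = 0) (lam δ : Param d) :
    Integrable (fun u => inner ℝ (potGrad ℓ (reparam lam u)) (reparam δ u)) (base d ν) := by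
  refine Integrable.mono' ((hν.integrable_norm_mul_norm (lam - pointParam zbar) δ).const_mul L)
    ((h.continuous_potGrad.comp (continuous_reparam lam)).inner
      (continuous_reparam δ)).aestronglyMeasurable (Filter.Eventually.of_forall fun u => ?_)
  refine (norm_inner_le_norm _ _).trans ?_
  rw [← mul_assoc]
  gcongr
  exact h.norm_potGrad_reparam_le hz lam u

/-- Convexity used from both ends of the segment between `z̄` and `x = T_λ(u)` gives `0 ≤ log ℓ(z̄)
- log ℓ(x) ≤ L‖x - z̄‖²`. -/
theorem integrable_neg_log (hν : StandardBase ν) {μ L : ℝ} (hμ : 0 < μ) {ℓ : Vec d → ℝ}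
    (hconc : StronglyLogConcave μ ℓ) (h : LogSmooth L ℓ) {zbar : Vec d}
    (hz : potGrad ℓ zbar = 0) (lam : Param d) :
    Integrable (fun u => -Real.log (ℓ (reparam lam u))) (base d ν) := by
  have := hν.isProb
  refine Integrable.mono' ((integrable_const |Real.log (ℓ zbar)|).add
    ((hν.norm_reparam_sq_moment (lam - pointParam zbar)).1.const_mul L))
    ((h.1.continuous.comp (continuous_reparam lam)).neg).aestronglyMeasurable
    (Filter.Eventually.of_forall fun u => ?_)
  have h1 := hconc zbar (reparam lam u)
  have h2 := hconc (reparam lam u) zbar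
  have h3 := real_inner_le_norm (potGrad ℓ (reparam lam u)) (reparam lam u - zbar)
  have h4 := h.norm_potGrad_reparam_le hz lam u
  rw [reparam_sub_point] at h4
  have h5 := mul_le_mul_of_nonneg_right h4 (norm_nonneg (reparam lam u - zbar))
  have h6 : inner ℝ (potGrad ℓ zbar) (zbar - reparam lam u) = 0 := by rw [hz, inner_zero_left]
  simp only [potGrad] at h3 h5 h6
  rw [h6] at h1
  have h7 : 0 ≤ μ / 2 * ‖zbar - reparam lam u‖ ^ 2 := by positivity
  have h8 : 0 ≤ μ / 2 * ‖reparam lam u - zbar‖ ^ 2 := by positivity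
  have h9 : 0 ≤ L * ‖reparam lam u - zbar‖ ^ 2 := by
    nlinarith [norm_nonneg (potGrad ℓ (reparam lam u)), norm_nonneg (reparam lam u - zbar)]
  have h10 := neg_abs_le (Real.log (ℓ zbar))
  have h11 := le_abs_self (Real.log (ℓ zbar))
  rw [Pi.add_apply, reparam_sub_point, Real.norm_eq_abs, abs_le]
  constructor <;> nlinarith

theorem negELBO_eq (hν : StandardBase ν) {L : ℝ} {ℓ : Vec d → ℝ} (h : LogSmooth L ℓ)
    {lam : Param d} (hlam : ∀ i, 0 < scale lam i i) :
    negELBO ν ℓ lam = ∫ u, -Real.log (ℓ (reparam lam u)) ∂(base d ν)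
      - (-∫ x, Real.log ((base d ν).rnDeriv volume x).toReal ∂(base d ν)
        + ∑ i, Real.log (scale lam i i)) := by
  rw [negELBO, diffEntropy_varDist hν hlam, varDist,
    integral_map (continuous_reparam lam).aemeasurable]
  exact h.1.continuous.neg.aestronglyMeasurable

theorem integrable_inner_stepDir (hν : StandardBase ν) {L : ℝ} {ℓ : Vec d → ℝ}
    (h : LogSmooth L ℓ) {zbar : Vec d} (hz : potGrad ℓ zbar = 0) (lam δ : Param d) :
    Integrable (fun u => inner ℝ (stepDir ℓ lam u) δ) (base d ν) := by
  have := hν.isProb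
  simp_rw [stepDir, inner_sub_left, inner_reparamAdj]
  exact (integrable_inner_potGrad hν h hz lam δ).sub (integrable_const _)

/-- The estimator is, on average, a subgradient of the strongly convex negative evidence lower
bound. -/
theorem integral_inner_stepDir_ge (hν : StandardBase ν) {μ L : ℝ} (hμ : 0 < μ) {ℓ : Vec d → ℝ}
    (hconc : StronglyLogConcave μ ℓ) (h : LogSmooth L ℓ) {zbar : Vec d}
    (hz : potGrad ℓ zbar = 0) {lam lam' : Param d} (hlam : ∀ i, 0 < scale lam i i)
    (hlam' : ∀ i, 0 < scale lam' i i) :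
    negELBO ν ℓ lam - negELBO ν ℓ lam' + μ / 2 * ‖lam - lam'‖ ^ 2
      ≤ ∫ u, inner ℝ (stepDir ℓ lam u) (lam - lam') ∂(base d ν) := by
  have := hν.isProb
  have i1 := integrable_neg_log hν hμ hconc h hz lam
  have i2 := integrable_neg_log hν hμ hconc h hz lam'
  have i3 := (hν.norm_reparam_sq_moment (lam - lam')).1.const_mul (μ / 2)
  have i4 := integrable_inner_potGrad hν h hz lam (lam - lam')
  have i5 : Integrable (fun u => -Real.log (ℓ (reparam lam u)) - -Real.log (ℓ (reparam lam' u)))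
    (base d ν) := i1.sub i2
  have e1 : ∫ u, (-Real.log (ℓ (reparam lam u)) - -Real.log (ℓ (reparam lam' u))
        + μ / 2 * ‖reparam (lam - lam') u‖ ^ 2) ∂(base d ν)
      ≤ ∫ u, inner ℝ (potGrad ℓ (reparam lam u)) (reparam (lam - lam') u) ∂(base d ν) :=
    integral_mono (i5.add i3) i4 fun u => by
      have := hconc (reparam lam u) (reparam lam' u)
      simp only [reparam_sub]
      exact this
  rw [integral_add i5 i3, integral_sub i1 i2, integral_const_mul,
    (hν.norm_reparam_sq_moment (lam - lam')).2] at e1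
  -- Concavity of the logarithm, entry by entry: `1 - q/p ≤ log p - log q`.
  have e2 : inner ℝ (logDetGrad lam) (lam - lam')
      ≤ ∑ i, Real.log (scale lam i i) - ∑ i, Real.log (scale lam' i i) := by
    rw [inner_sub_right, inner_logDetGrad, inner_logDetGrad, ← Finset.sum_sub_distrib,
      ← Finset.sum_sub_distrib]
    refine Finset.sum_le_sum fun i _ => ?_
    have hp := hlam i
    have hq := hlam' i
    have := Real.log_le_sub_one_of_pos (div_pos hq hp)
    rw [Real.log_div hq.ne' hp.ne'] at this
    rw [inv_mul_cancel₀ hp.ne', ← div_eq_inv_mul]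
    linarith
  simp_rw [stepDir, inner_sub_left, inner_reparamAdj]
  rw [integral_sub i4 (integrable_const _), integral_const, negELBO_eq hν h hlam,
    negELBO_eq hν h hlam']
  simp only [probReal_univ, one_smul]
  linarith

theorem domain_diag_pos {L : ℝ} (hL : 0 < L) {lam : Param d} (h : lam ∈ domain d L) (i : Fin d) :
    0 < scale lam i i :=
  lt_of_lt_of_le (by positivity) (h i)

theorem convex_domain (d : ℕ) (L : ℝ) : Convex ℝ (domain d L) := by
  intro x hx y hy a b ha hb hab i
  have h1 := hx i
  have h2 := hy i
  rw [scale_diag] at h1 h2 ⊢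
  simp only [PiLp.add_apply, PiLp.smul_apply, smul_eq_mul]
  calc 1 / Real.sqrt L = a * (1 / Real.sqrt L) + b * (1 / Real.sqrt L) := by
        rw [← add_mul, hab, one_mul]
    _ ≤ _ := by gcongr

/-- Quadratic growth of the negative evidence lower bound at its minimizer. -/
theorem negELBO_growth (hν : StandardBase ν) {μ L : ℝ} (hμ : 0 < μ) (hL : 0 < L) {ℓ : Vec d → ℝ}
    (hconc : StronglyLogConcave μ ℓ) (h : LogSmooth L ℓ) {zbar : Vec d}
    (hz : potGrad ℓ zbar = 0) {lamStar lam : Param d} (hs : lamStar ∈ domain d L)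
    (hmin : IsMinOn (negELBO ν ℓ) (domain d L) lamStar) (hlam : lam ∈ domain d L) :
    μ / 2 * ‖lam - lamStar‖ ^ 2 ≤ negELBO ν ℓ lam - negELBO ν ℓ lamStar := by
  -- The subgradient inequality at a point `lt` of the segment is applied toward both ends. With
  -- weights `t` and `1 - t` the gradient terms cancel, leaving strong convexity along the segment;
  -- then `F(λ*) ≤ F(lt)`, division by `t` and `t → 0` finish. No derivative of `F` is needed.
  have key : ∀ t ∈ Set.Ioo (0 : ℝ) 1, (1 - t) * (μ / 2 * ‖lam - lamStar‖ ^ 2)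
      ≤ negELBO ν ℓ lam - negELBO ν ℓ lamStar := by
    intro t ht
    obtain ⟨ht0, ht1⟩ := ht
    set lt : Param d := (1 - t) • lamStar + t • lam with hlt
    have hmem : lt ∈ domain d L :=
      convex_domain d L hs hlam (by linarith) ht0.le (by ring)
    have a1 := integral_inner_stepDir_ge hν hμ hconc h hz (domain_diag_pos hL hmem)
      (domain_diag_pos hL hlam)
    have a2 := integral_inner_stepDir_ge hν hμ hconc h hz (domain_diag_pos hL hmem)
      (domain_diag_pos hL hs)
    have e1 : lt - lam = (-(1 - t)) • (lam - lamStar) := by rw [hlt]; module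
    have e2 : lt - lamStar = t • (lam - lamStar) := by rw [hlt]; module
    simp_rw [e1, inner_smul_right, integral_const_mul, norm_smul, mul_pow] at a1
    simp_rw [e2, inner_smul_right, integral_const_mul, norm_smul, mul_pow] at a2
    rw [Real.norm_eq_abs, sq_abs] at a1 a2
    have a3 : negELBO ν ℓ lamStar ≤ negELBO ν ℓ lt := hmin hmem
    set I := ∫ u, inner ℝ (stepDir ℓ lt u) (lam - lamStar) ∂(base d ν)
    set D := ‖lam - lamStar‖ ^ 2
    have b1 := mul_le_mul_of_nonneg_left a1 ht0.le
    have b2 := mul_le_mul_of_nonneg_left a2 (sub_nonneg.2 ht1.le)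
    refine le_of_mul_le_mul_left ?_ ht0
    nlinarith
  have hlim : Filter.Tendsto (fun t : ℝ => (1 - t) * (μ / 2 * ‖lam - lamStar‖ ^ 2))
      (nhdsWithin 0 (Set.Ioi 0)) (nhds ((1 - 0) * (μ / 2 * ‖lam - lamStar‖ ^ 2))) := by
    refine Filter.Tendsto.mono_left (Continuous.tendsto (by fun_prop) _) nhdsWithin_le_nhds
  rw [sub_zero, one_mul] at hlim
  refine le_of_tendsto hlim ?_
  filter_upwards [Ioo_mem_nhdsGT (zero_lt_one' ℝ)] with t ht using key t ht

/-! ### Second moment of the estimator -/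

/-- The threshold `1/√L` gives `L C_ii² ≥ 1`, that is `1/C_ii ≤ L C_ii`, and `C_ii` is an entry of
`λ - λ̄` because `λ̄` has zero scale. -/
theorem norm_logDetGrad_sq_le {L : ℝ} (hL : 0 < L) {lam : Param d} (h : lam ∈ domain d L)
    (z : Vec d) : ‖logDetGrad lam‖ ^ 2 ≤ L ^ 2 * ‖lam - pointParam z‖ ^ 2 := by
  rw [norm_sq_eq, norm_sq_eq]
  simp only [loc_logDetGrad, scale_logDetGrad]
  have h1 : ∀ i : Fin d, ∑ j, (if i = j then (scale lam i j)⁻¹ else 0) ^ 2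
      ≤ L ^ 2 * ∑ j, scale (lam - pointParam z) i j ^ 2 := by
    intro i
    have e : ∑ j, (if i = j then (scale lam i j)⁻¹ else 0) ^ 2 = (scale lam i i)⁻¹ ^ 2 := by
      rw [Finset.sum_eq_single i] <;> simp +contextual [eq_comm]
    have e2 : scale (lam - pointParam z) i i = scale lam i i := by
      simp [scale_diag, pointParam]
    have hp := domain_diag_pos hL h i
    have h2 : (scale lam i i)⁻¹ ≤ L * scale lam i i := by
      have h3 := h i
      rw [div_le_iff₀ (Real.sqrt_pos.2 hL)] at h3
      rw [inv_le_iff_one_le_mul₀ hp]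
      calc (1 : ℝ) ≤ (scale lam i i * Real.sqrt L) ^ 2 := one_le_pow₀ h3
        _ = L * scale lam i i * scale lam i i := by rw [mul_pow, Real.sq_sqrt hL.le]; ring
    calc _ = (scale lam i i)⁻¹ ^ 2 := e
      _ ≤ (L * scale lam i i) ^ 2 := by gcongr
      _ = L ^ 2 * scale (lam - pointParam z) i i ^ 2 := by rw [e2, mul_pow]
      _ ≤ _ := by
        gcongr
        exact Finset.single_le_sum (f := fun j => scale (lam - pointParam z) i j ^ 2)
          (fun j _ => sq_nonneg _) (Finset.mem_univ i)
  calc _ = ∑ i : Fin d, ∑ j, (if i = j then (scale lam i j)⁻¹ else 0) ^ 2 := by simp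
    _ ≤ ∑ i : Fin d, L ^ 2 * ∑ j, scale (lam - pointParam z) i j ^ 2 :=
      Finset.sum_le_sum fun i _ => h1 i
    _ = L ^ 2 * ∑ i : Fin d, ∑ j, scale (lam - pointParam z) i j ^ 2 := by
      rw [Finset.mul_sum]
    _ ≤ _ := by
      gcongr
      exact le_add_of_nonneg_left (Finset.sum_nonneg fun i _ => sq_nonneg _)

/-- The second moment of the estimator. -/
theorem norm_stepDir_sq_moment (hν : StandardBase ν) {L : ℝ} (hL : 0 < L) {ℓ : Vec d → ℝ}
    (h : LogSmooth L ℓ) {zbar : Vec d} (hz : potGrad ℓ zbar = 0) {lam : Param d}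
    (hlam : lam ∈ domain d L) :
    Integrable (fun u => ‖stepDir ℓ lam u‖ ^ 2) (base d ν) ∧
      ∫ u, ‖stepDir ℓ lam u‖ ^ 2 ∂(base d ν)
        ≤ L ^ 2 * (d + kurt ν + 4) * ‖lam - pointParam zbar‖ ^ 2 := by
  have := hν.isProb
  set δ := lam - pointParam zbar with hδ
  set η := logDetGrad lam with hη
  obtain ⟨i1, m1⟩ := hν.norm_reparam_sq_moment δ
  obtain ⟨i2, m2⟩ := hν.sum_sq_mul_norm_reparam_sq_moment δ
  obtain ⟨i3, m3⟩ := hν.norm_reparam_sq_moment η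
  have hη2 : ‖η‖ ^ 2 ≤ L ^ 2 * ‖δ‖ ^ 2 := norm_logDetGrad_sq_le hL hlam zbar
  -- The cross term is `-2⟨v, T_η(u)⟩ ≤ ‖v‖² + ‖T_η(u)‖²`, where `v` is the gradient of `-log ℓ` at
  -- `T_λ(u)`. In the mean the four terms total at most `d + k_φ + 3` times `L²‖δ‖²`, one less than
  -- claimed.
  have bound : ∀ u, ‖stepDir ℓ lam u‖ ^ 2
      ≤ L ^ 2 * ((∑ j, u j ^ 2) * ‖reparam δ u‖ ^ 2) + 2 * L ^ 2 * ‖reparam δ u‖ ^ 2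
        + ‖reparam η u‖ ^ 2 + ‖η‖ ^ 2 := by
    intro u
    have hg := h.norm_potGrad_reparam_le hz lam u
    rw [← hδ] at hg
    have hg2 : ‖potGrad ℓ (reparam lam u)‖ ^ 2 ≤ L ^ 2 * ‖reparam δ u‖ ^ 2 := by
      rw [← mul_pow]; gcongr
    have ha := norm_reparamAdj_sq_le u (potGrad ℓ (reparam lam u))
    have hb : -inner ℝ (potGrad ℓ (reparam lam u)) (reparam η u)
        ≤ ‖potGrad ℓ (reparam lam u)‖ * ‖reparam η u‖ :=
      (neg_le_abs _).trans (abs_real_inner_le_norm _ _)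
    have hs : 0 ≤ ∑ j, u j ^ 2 := Finset.sum_nonneg fun j _ => sq_nonneg _
    have hc := mul_le_mul_of_nonneg_left hg2 (by linarith : 0 ≤ 1 + ∑ j, u j ^ 2)
    rw [stepDir, norm_sub_sq_real, inner_reparamAdj, ← hη]
    nlinarith [sq_nonneg (‖potGrad ℓ (reparam lam u)‖ - ‖reparam η u‖)]
  have j1 : Integrable (fun u => L ^ 2 * ((∑ j, u j ^ 2) * ‖reparam δ u‖ ^ 2)
      + 2 * L ^ 2 * ‖reparam δ u‖ ^ 2) (base d ν) := (i2.const_mul _).add (i1.const_mul _)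
  have j2 : Integrable (fun u => L ^ 2 * ((∑ j, u j ^ 2) * ‖reparam δ u‖ ^ 2)
      + 2 * L ^ 2 * ‖reparam δ u‖ ^ 2 + ‖reparam η u‖ ^ 2) (base d ν) := j1.add i3
  have j3 : Integrable (fun u => L ^ 2 * ((∑ j, u j ^ 2) * ‖reparam δ u‖ ^ 2)
      + 2 * L ^ 2 * ‖reparam δ u‖ ^ 2 + ‖reparam η u‖ ^ 2 + ‖η‖ ^ 2) (base d ν) :=
    j2.add (integrable_const _)
  have j4 : Integrable (fun u => ‖stepDir ℓ lam u‖ ^ 2) (base d ν) := by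
    refine Integrable.mono' j3 ?_ (Filter.Eventually.of_forall fun u => ?_)
    · exact (((measurable_uncurry_stepDir h).comp
        (measurable_const.prodMk measurable_id)).norm.pow_const 2).aestronglyMeasurable
    · rw [Real.norm_of_nonneg (by positivity)]
      exact bound u
  refine ⟨j4, (integral_mono j4 j3 bound).trans ?_⟩
  rw [integral_add j2 (integrable_const _), integral_add j1 i3,
    integral_add (i2.const_mul _) (i1.const_mul _), integral_const_mul, integral_const_mul,
    m1, m3, integral_const]
  simp only [probReal_univ, one_smul]
  have := mul_le_mul_of_nonneg_left m2 (sq_nonneg L)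
  have h0 : 0 ≤ L ^ 2 * ‖δ‖ ^ 2 := by positivity
  nlinarith

/-! ### Projection and the SGD step -/

/-- Entry by entry: raising `C_ii` to the threshold moves it toward every admissible value. -/
theorem norm_proj_sub_le (S : ℝ) (lam : Param d) {lam' : Param d} (h : lam' ∈ domain d S) :
    ‖proj S lam - lam'‖ ≤ ‖lam - lam'‖ := by
  refine le_of_sq_le_sq ?_ (norm_nonneg _)
  rw [EuclideanSpace.real_norm_sq_eq, EuclideanSpace.real_norm_sq_eq]
  refine Finset.sum_le_sum fun x _ => ?_
  rcases x with i | ⟨⟨i, j⟩, hij⟩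
  · simp [proj]
  · by_cases e : i = j
    · subst e
      have h1 : 1 / Real.sqrt S ≤ lam' (Sum.inr ⟨(i, i), hij⟩) := by
        simpa [scale] using h i
      simp only [proj, PiLp.sub_apply, Sum.elim_inr, if_true]
      rcases le_total (lam (Sum.inr ⟨(i, i), hij⟩)) (1 / Real.sqrt S) with h2 | h2
      · rw [max_eq_right h2]
        nlinarith
      · rw [max_eq_left h2]
    · simp [proj, e]

theorem measurable_proj (S : ℝ) : Measurable (proj S : Param d → Param d) := by
  refine (PiLp.continuous_toLp 2 _).measurable.comp (measurable_pi_lambda _ fun i => ?_)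
  rcases i with i | p <;> simp only [Sum.elim_inl, Sum.elim_inr]
  · fun_prop
  · split_ifs <;> fun_prop

/-- One step of projected stochastic gradient descent. -/
noncomputable def sgdStep (ℓ : Vec d → ℝ) (S γ : ℝ) (lam : Param d) (u : Fin d → ℝ) : Param d :=
  proj S (lam - γ • stepDir ℓ lam u)

theorem sgd_mem_domain (ℓ : Vec d → ℝ) (S γ : ℝ) {lam0 : Param d} (h : lam0 ∈ domain d S)
    (u : ℕ → Fin d → ℝ) (t : ℕ) : sgd ν ℓ S γ lam0 u t ∈ domain d S := by
  cases t with
  | zero => exact h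
  | succ t => exact proj_mem _ _

theorem sgd_succ (hν : StandardBase ν) {L : ℝ} (hL : 0 < L) {ℓ : Vec d → ℝ} (h : LogSmooth L ℓ)
    (γ : ℝ) {lam0 : Param d} (h0 : lam0 ∈ domain d L) (u : ℕ → Fin d → ℝ) (t : ℕ) :
    sgd ν ℓ L γ lam0 u (t + 1) = sgdStep ℓ L γ (sgd ν ℓ L γ lam0 u t) (u t) := by
  rw [sgd, cfe_eq_stepDir hν h (domain_diag_pos hL (sgd_mem_domain ℓ L γ h0 u t)), sgdStep]

theorem measurable_uncurry_sgdStep {L : ℝ} {ℓ : Vec d → ℝ} (h : LogSmooth L ℓ) (γ : ℝ) :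
    Measurable fun p : Param d × (Fin d → ℝ) => sgdStep ℓ L γ p.1 p.2 :=
  (measurable_proj L).comp (measurable_fst.sub ((measurable_uncurry_stepDir h).const_smul γ))

/-! ### Recursions driven by independent samples -/

/-- A process driven by an independent sequence is a function of the past of that sequence. -/
theorem exists_measurable_past {Ω E U : Type*} [MeasurableSpace E] [MeasurableSpace U]
    {F : E × U → E} (hF : Measurable F) {X : ℕ → Ω → E} {u : ℕ → Ω → U} {x0 : E}
    (h0 : ∀ ω, X 0 ω = x0) (hs : ∀ t ω, X (t + 1) ω = F (X t ω, u t ω)) (t : ℕ) :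
    ∃ Φ : (Finset.range t → U) → E, Measurable Φ ∧ ∀ ω, X t ω = Φ fun i => u i ω := by
  induction t with
  | zero => exact ⟨fun _ => x0, measurable_const, h0⟩
  | succ t ih =>
    obtain ⟨Φ, hΦ, hX⟩ := ih
    refine ⟨fun v => F (Φ fun i => v ⟨i, Finset.mem_range.2
        ((Finset.mem_range.1 i.2).trans t.lt_succ_self)⟩,
      v ⟨t, Finset.self_mem_range_succ t⟩), ?_, fun ω => ?_⟩
    · exact hF.comp ((hΦ.comp (measurable_pi_lambda _ fun i => measurable_pi_apply _)).prodMk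
        (measurable_pi_apply _))
    · rw [hs, hX]

/-- `X t` depends only on `u 0, …, u (t - 1)`, which are jointly independent of `u t`. -/
theorem measurable_and_indepFun_of_recursion {Ω E U : Type*} [MeasurableSpace Ω]
    [MeasurableSpace E] [MeasurableSpace U] {P : Measure Ω}
    {F : E × U → E} (hF : Measurable F) {X : ℕ → Ω → E} {u : ℕ → Ω → U} {x0 : E}
    (h0 : ∀ ω, X 0 ω = x0) (hs : ∀ t ω, X (t + 1) ω = F (X t ω, u t ω))
    (hu : ∀ t, Measurable (u t)) (hind : iIndepFun u P) (t : ℕ) :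
    Measurable (X t) ∧ IndepFun (X t) (u t) P := by
  obtain ⟨Φ, hΦ, hX⟩ := exists_measurable_past hF h0 hs t
  have e : X t = Φ ∘ fun ω i => u i ω := funext hX
  rw [e]
  refine ⟨hΦ.comp (measurable_pi_lambda _ fun i => hu i), ?_⟩
  have h1 := hind.indepFun_finset (Finset.range t) {t} (by simp) hu
  exact h1.comp hΦ (measurable_pi_apply (⟨t, Finset.mem_singleton_self t⟩ : ({t} : Finset ℕ)))

/-- If the conditional mean of a nonnegative functional contracts along a recursion, so does its
mean. -/
theorem integral_recursion_step {Ω E U : Type*} [MeasurableSpace Ω] [MeasurableSpace E]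
    [MeasurableSpace U] {P : Measure Ω} [IsProbabilityMeasure P] {ρ : Measure U}
    [IsProbabilityMeasure ρ] {X : Ω → E} {u : Ω → U} (hX : Measurable X) (hu : Measurable u)
    (hlaw : P.map u = ρ) (hind : IndepFun X u P) {V : E → ℝ} (hV : Measurable V)
    (hV0 : ∀ x, 0 ≤ V x) {F : E × U → E} (hF : Measurable F) {D : Set E} (hD : ∀ ω, X ω ∈ D)
    {r c : ℝ} (hi : ∀ x ∈ D, Integrable (fun v => V (F (x, v))) ρ)
    (hc : ∀ x ∈ D, ∫ v, V (F (x, v)) ∂ρ ≤ r * V x + c) (hVX : Integrable (fun ω => V (X ω)) P) :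
    Integrable (fun ω => V (F (X ω, u ω))) P ∧
      ∫ ω, V (F (X ω, u ω)) ∂P ≤ r * ∫ ω, V (X ω) ∂P + c := by
  have hb : Integrable (fun ω => r * V (X ω) + c) P := (hVX.const_mul r).add (integrable_const c)
  -- Nonnegativity comes from dominating a nonnegative integral, so `r` and `c` need no sign
  -- condition.
  have hb0 : ∀ ω, 0 ≤ r * V (X ω) + c := fun ω =>
    (integral_nonneg fun v => hV0 _).trans (hc _ (hD ω))
  have hm : Measurable fun p : E × U => ENNReal.ofReal (V (F p)) := (hV.comp hF).ennreal_ofReal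
  -- Tonelli is used with lower integrals because integrability of the left side is part of the
  -- claim.
  have hle : ∫⁻ ω, ENNReal.ofReal (V (F (X ω, u ω))) ∂P
      ≤ ENNReal.ofReal (∫ ω, (r * V (X ω) + c) ∂P) := by
    calc ∫⁻ ω, ENNReal.ofReal (V (F (X ω, u ω))) ∂P
        = ∫⁻ p, ENNReal.ofReal (V (F p)) ∂(P.map fun ω => (X ω, u ω)) :=
          (lintegral_map hm (hX.prodMk hu)).symm
      _ = ∫⁻ x, ∫⁻ v, ENNReal.ofReal (V (F (x, v))) ∂ρ ∂(P.map X) := by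
          rw [hind.map_prod_eq_prod_map_map hX.aemeasurable hu.aemeasurable, hlaw,
            lintegral_prod _ hm.aemeasurable]
      _ = ∫⁻ ω, ∫⁻ v, ENNReal.ofReal (V (F (X ω, v))) ∂ρ ∂P :=
          lintegral_map hm.lintegral_prod_right' hX
      _ ≤ ∫⁻ ω, ENNReal.ofReal (r * V (X ω) + c) ∂P := by
          refine lintegral_mono fun ω => ?_
          rw [← ofReal_integral_eq_lintegral_ofReal (hi _ (hD ω))
            (Filter.Eventually.of_forall fun v => hV0 _)]
          exact ENNReal.ofReal_le_ofReal (hc _ (hD ω))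
      _ = ENNReal.ofReal (∫ ω, (r * V (X ω) + c) ∂P) :=
          (ofReal_integral_eq_lintegral_ofReal hb (Filter.Eventually.of_forall hb0)).symm
  have hint : Integrable (fun ω => V (F (X ω, u ω))) P := by
    refine ⟨(hV.comp (hF.comp (hX.prodMk hu))).aestronglyMeasurable, ?_⟩
    rw [hasFiniteIntegral_iff_ofReal (Filter.Eventually.of_forall fun ω => hV0 _)]
    exact hle.trans_lt ENNReal.ofReal_lt_top
  refine ⟨hint, ?_⟩
  rw [← ofReal_integral_eq_lintegral_ofReal hint (Filter.Eventually.of_forall fun ω => hV0 _),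
    ENNReal.ofReal_le_ofReal_iff (integral_nonneg hb0),
    integral_add (hVX.const_mul r) (integrable_const c), integral_const_mul] at hle
  simpa using hle

/-! ### Contraction and geometric convergence -/

/-- A strong convexity constant is at most a smoothness constant. -/
theorem strongConvexity_le_smoothness [Nonempty (Fin d)] {μ L : ℝ} {ℓ : Vec d → ℝ}
    (hconc : StronglyLogConcave μ ℓ) (h : LogSmooth L ℓ) : μ ≤ L := by
  obtain ⟨i⟩ := ‹Nonempty (Fin d)›
  set z : Vec d := EuclideanSpace.single i 1
  have hz : ‖z‖ = 1 := by simp [z]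
  -- Adding the two strong convexity inequalities between `0` and a unit vector gives `μ ≤ ⟨∇(z) -
  -- ∇(0), z⟩ ≤ L`.
  have h1 := hconc z 0
  have h2 := hconc 0 z
  have h3 := real_inner_le_norm (potGrad ℓ z - potGrad ℓ 0) z
  have h4 := h.norm_potGrad_sub_le z 0
  simp only [sub_zero, zero_sub, inner_neg_right, norm_neg, hz] at h1 h2 h4
  rw [inner_sub_left, hz] at h3
  simp only [potGrad] at h3 h4
  linarith

/-- The mean squared distance to the minimizer contracts in one step, up to the variance of the
estimator at the minimizer. -/
theorem norm_sgdStep_sub_sq_moment (hν : StandardBase ν) {μ L : ℝ} (hμ : 0 < μ) (hL : 0 < L)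
    {ℓ : Vec d → ℝ} (hconc : StronglyLogConcave μ ℓ) (h : LogSmooth L ℓ) {zbar : Vec d}
    (hz : potGrad ℓ zbar = 0) {lamStar : Param d} (hs : lamStar ∈ domain d L)
    (hmin : IsMinOn (negELBO ν ℓ) (domain d L) lamStar) {γ : ℝ} (hγ : 0 ≤ γ)
    (hγ' : γ * (2 * L ^ 2 * (d + kurt ν + 4)) ≤ μ) {lam : Param d} (hlam : lam ∈ domain d L) :
    Integrable (fun u => ‖sgdStep ℓ L γ lam u - lamStar‖ ^ 2) (base d ν) ∧
      ∫ u, ‖sgdStep ℓ L γ lam u - lamStar‖ ^ 2 ∂(base d ν)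
        ≤ (1 - γ * μ) * ‖lam - lamStar‖ ^ 2
          + γ ^ 2 * (2 * L ^ 2 * (d + kurt ν + 4)) * ‖pointParam zbar - lamStar‖ ^ 2 := by
  have := hν.isProb
  have hk := hν.one_le_kurt
  obtain ⟨i1, m1⟩ := norm_stepDir_sq_moment hν hL h hz hlam
  have i2 := integrable_inner_stepDir hν h hz lam (lam - lamStar)
  have m2 := integral_inner_stepDir_ge hν hμ hconc h hz (domain_diag_pos hL hlam)
    (domain_diag_pos hL hs)
  have m3 := negELBO_growth hν hμ hL hconc h hz hs hmin hlam
  have bound : ∀ u, ‖sgdStep ℓ L γ lam u - lamStar‖ ^ 2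
      ≤ ‖lam - lamStar‖ ^ 2 - 2 * γ * inner ℝ (stepDir ℓ lam u) (lam - lamStar)
        + γ ^ 2 * ‖stepDir ℓ lam u‖ ^ 2 := by
    intro u
    have h1 := norm_proj_sub_le L (lam - γ • stepDir ℓ lam u) hs
    have h2 : ‖lam - γ • stepDir ℓ lam u - lamStar‖ ^ 2
        = ‖lam - lamStar‖ ^ 2 - 2 * γ * inner ℝ (stepDir ℓ lam u) (lam - lamStar)
          + γ ^ 2 * ‖stepDir ℓ lam u‖ ^ 2 := by
      rw [sub_right_comm, norm_sub_sq_real, inner_smul_right, norm_smul, mul_pow,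
        Real.norm_eq_abs, sq_abs, real_inner_comm]
      ring
    rw [← h2, sgdStep]
    gcongr
  have j1 : Integrable (fun u => ‖lam - lamStar‖ ^ 2
      - 2 * γ * inner ℝ (stepDir ℓ lam u) (lam - lamStar)) (base d ν) :=
    (integrable_const _).sub (i2.const_mul _)
  have j2 : Integrable (fun u => ‖lam - lamStar‖ ^ 2
      - 2 * γ * inner ℝ (stepDir ℓ lam u) (lam - lamStar)
        + γ ^ 2 * ‖stepDir ℓ lam u‖ ^ 2) (base d ν) := j1.add (i1.const_mul _)
  have j3 : Integrable (fun u => ‖sgdStep ℓ L γ lam u - lamStar‖ ^ 2) (base d ν) := by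
    refine Integrable.mono' j2 ?_ (Filter.Eventually.of_forall fun u => ?_)
    · exact ((((measurable_uncurry_sgdStep h γ).comp
        (measurable_const.prodMk measurable_id)).sub measurable_const).norm.pow_const
          2).aestronglyMeasurable
    · rw [Real.norm_of_nonneg (by positivity)]
      exact bound u
  refine ⟨j3, (integral_mono j3 j2 bound).trans ?_⟩
  rw [integral_add j1 (i1.const_mul _), integral_sub (integrable_const _) (i2.const_mul _),
    integral_const_mul, integral_const_mul, integral_const]
  simp only [probReal_univ, one_smul]
  -- Recenters the second moment bound from `λ̄` to `λ*`; this is the source of the factor `2` in `2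
  -- * L ^ 2`.
  have tri : ‖lam - pointParam zbar‖ ^ 2
      ≤ 2 * ‖lam - lamStar‖ ^ 2 + 2 * ‖pointParam zbar - lamStar‖ ^ 2 := by
    have h1 := norm_sub_le (lam - lamStar) (pointParam zbar - lamStar)
    rw [sub_sub_sub_cancel_right] at h1
    have h2 : ‖lam - pointParam zbar‖ ^ 2
        ≤ (‖lam - lamStar‖ + ‖pointParam zbar - lamStar‖) ^ 2 := by gcongr
    nlinarith [sq_nonneg (‖lam - lamStar‖ - ‖pointParam zbar - lamStar‖)]
  set A : ℝ := L ^ 2 * (d + kurt ν + 4) with hA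
  have hA0 : 0 ≤ A := by positivity
  have e : 2 * L ^ 2 * (d + kurt ν + 4) = 2 * A := by rw [hA]; ring
  rw [e] at hγ' ⊢
  set Q := ‖lam - lamStar‖ ^ 2
  set B := ‖pointParam zbar - lamStar‖ ^ 2
  have hQ : 0 ≤ Q := by positivity
  have s1 := mul_le_mul_of_nonneg_left (m1.trans (mul_le_mul_of_nonneg_left tri hA0)) (sq_nonneg γ)
  have s2 : 2 * γ * (μ * Q)
      ≤ 2 * γ * ∫ u, inner ℝ (stepDir ℓ lam u) (lam - lamStar) ∂(base d ν) :=
    mul_le_mul_of_nonneg_left (by linarith) (by positivity)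
  -- The drift contributes `-2γμQ`; the stepsize condition bounds the noise term `2γ²AQ` by `γμQ`,
  -- which leaves the factor `1 - γμ`.
  have s3 := mul_le_mul_of_nonneg_right (mul_le_mul_of_nonneg_left hγ' hγ) hQ
  nlinarith

/-- Geometric convergence of projected stochastic gradient descent in mean square. -/
theorem sgd_norm_sub_sq_moment (hν : StandardBase ν) {μ L : ℝ} (hμ : 0 < μ) (hL : 0 < L)
    {ℓ : Vec d → ℝ} (hconc : StronglyLogConcave μ ℓ) (h : LogSmooth L ℓ) {zbar : Vec d}
    (hz : potGrad ℓ zbar = 0) {lamStar : Param d} (hs : lamStar ∈ domain d L)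
    (hmin : IsMinOn (negELBO ν ℓ) (domain d L) lamStar) {γ ε : ℝ} (hγ : 0 ≤ γ)
    (hγ' : γ * (2 * L ^ 2 * (d + kurt ν + 4)) ≤ μ) (hr : γ * μ ≤ 1)
    (hε : γ * (2 * L ^ 2 * (d + kurt ν + 4)) * ‖pointParam zbar - lamStar‖ ^ 2 ≤ μ * (ε / 2))
    (hε0 : 0 ≤ ε)
    {Ω : Type*} [MeasurableSpace Ω] {P : Measure Ω} [IsProbabilityMeasure P]
    {u : ℕ → Ω → Fin d → ℝ} (hu : ∀ t, Measurable (u t)) (hlaw : ∀ t, P.map (u t) = base d ν)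
    (hind : iIndepFun u P) {lam0 : Param d} (h0 : lam0 ∈ domain d L) (t : ℕ) :
    Integrable (fun ω => ‖sgd ν ℓ L γ lam0 (fun t => u t ω) t - lamStar‖ ^ 2) P ∧
      ∫ ω, ‖sgd ν ℓ L γ lam0 (fun t => u t ω) t - lamStar‖ ^ 2 ∂P
        ≤ (1 - γ * μ) ^ t * ‖lam0 - lamStar‖ ^ 2 + ε / 2 := by
  have := hν.isProb
  induction t with
  | zero =>
    simp only [sgd]
    refine ⟨integrable_const _, ?_⟩
    simp only [integral_const, probReal_univ, one_smul, pow_zero, one_mul]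
    linarith
  | succ t ih =>
    have hF := measurable_uncurry_sgdStep h γ
    have hX := measurable_and_indepFun_of_recursion (P := P) hF
      (X := fun t ω => sgd ν ℓ L γ lam0 (fun t => u t ω) t) (u := u) (x0 := lam0)
      (fun ω => rfl) (fun t ω => sgd_succ hν hL h γ h0 _ t) hu hind t
    have hstep := fun lam (hlam : lam ∈ domain d L) =>
      norm_sgdStep_sub_sq_moment hν hμ hL hconc h hz hs hmin hγ hγ' hlam
    have key := integral_recursion_step (ρ := base d ν) hX.1 (hu t) (hlaw t) hX.2
      (V := fun lam => ‖lam - lamStar‖ ^ 2) (by fun_prop) (fun _ => by positivity) hF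
      (D := domain d L) (fun ω => sgd_mem_domain ℓ L γ h0 _ t)
      (fun lam hlam => (hstep lam hlam).1) (fun lam hlam => (hstep lam hlam).2) ih.1
    simp_rw [sgd_succ hν hL h γ h0]
    refine ⟨key.1, key.2.trans ?_⟩
    have h1 := mul_le_mul_of_nonneg_left ih.2 (sub_nonneg.2 hr)
    have h2 := mul_le_mul_of_nonneg_left hε hγ
    -- The level `ε/2` is preserved: the new error is at most `γμ · ε/2`, exactly what contraction
    -- removes from `ε/2`.
    linear_combination h1 + h2

end BBVI

/-! ### Choice of the stepsize and the iteration count -/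

theorem mainTheorem7 (d : ℕ) (ν : Measure ℝ) (hν : BBVI.StandardBase ν)
    (ℓ : BBVI.Vec d → ℝ) (hℓ : ∀ z, 0 < ℓ z)
    (μ L : ℝ) (hμ : 0 < μ) (hL : 0 < L)
    (hconc : BBVI.StronglyLogConcave μ ℓ) (hsmooth : BBVI.LogSmooth L ℓ)
    (zbar : BBVI.Vec d) (hzbar : gradient (fun z => Real.log (ℓ z)) zbar = 0)
    (lamStar : BBVI.Param d) (hstar_mem : lamStar ∈ BBVI.domain d L)
    (hstar : IsMinOn (BBVI.negELBO ν ℓ) (BBVI.domain d L) lamStar)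
    (ε : ℝ) (hε : 0 < ε) :
    ∃ γ : ℝ, 0 < γ ∧
      ∀ (Ω : Type*) [MeasurableSpace Ω] (P : Measure Ω) [IsProbabilityMeasure P]
        (u : ℕ → Ω → Fin d → ℝ),
        (∀ t, Measurable (u t)) → (∀ t, P.map (u t) = BBVI.base d ν) → iIndepFun u P →
        ∀ lam0 ∈ BBVI.domain d L, ∀ T : ℕ,
          2 * (L / μ) ^ 2 * (d + BBVI.kurt ν + 4)
              * (1 + 2 * ‖BBVI.pointParam zbar - lamStar‖ ^ 2 * (1 / ε))
              * Real.log (2 * ‖lam0 - lamStar‖ ^ 2 * (1 / ε)) ≤ (T : ℝ) →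
          (∀ ω, BBVI.sgd ν ℓ L γ lam0 (fun t => u t ω) T ∈ BBVI.domain d L) ∧
          Integrable
            (fun ω => ‖BBVI.sgd ν ℓ L γ lam0 (fun t => u t ω) T - lamStar‖ ^ 2) P ∧
          ∫ ω, ‖BBVI.sgd ν ℓ L γ lam0 (fun t => u t ω) T - lamStar‖ ^ 2 ∂P ≤ ε := by
  have hz : BBVI.potGrad ℓ zbar = 0 := by rw [BBVI.potGrad_eq, hzbar, neg_zero]
  have hk := hν.one_le_kurt
  -- For `d = 0` the inequality `μ ≤ L` may fail, but the parameter space is a single point and any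
  -- stepsize works.
  rcases isEmpty_or_nonempty (Fin d) with hd | hd
  · refine ⟨1, one_pos, fun Ω _ P _ u _ _ _ lam0 h0 T _ =>
      ⟨fun ω => BBVI.sgd_mem_domain ℓ L 1 h0 _ T, ?_⟩⟩
    have e : ∀ lam : BBVI.Param d, ‖lam - lamStar‖ ^ 2 = 0 := by
      intro lam
      rw [EuclideanSpace.real_norm_sq_eq]
      refine Finset.sum_eq_zero fun x _ => ?_
      rcases x with i | p
      · exact isEmptyElim i
      · exact isEmptyElim p.1.1
    simp_rw [e]
    exact ⟨integrable_const _, by simpa using hε.le⟩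
  have hμL : μ ≤ L := BBVI.strongConvexity_le_smoothness hconc hsmooth
  set B := ‖BBVI.pointParam zbar - lamStar‖ ^ 2 with hB
  have hB0 : 0 ≤ B := by positivity
  set W : ℝ := 1 + 2 * B * (1 / ε) with hW
  have hW1 : 1 ≤ W := by
    have : 0 ≤ 2 * B * (1 / ε) := by positivity
    linarith
  have hW0 : 0 < W := by linarith
  set A : ℝ := 2 * L ^ 2 * (d + BBVI.kurt ν + 4) with hA
  have hA0 : 0 < A := by positivity
  have hAL : μ * μ ≤ A := by
    have : (0 : ℝ) ≤ d := d.cast_nonneg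
    nlinarith [mul_le_mul hμL hμL hμ.le hL.le, sq_nonneg L]
  have hγA : μ / (A * W) * A = μ / W := by field_simp
  -- With this `γ`, `γA = μ/W ≤ μ`, and since `(ε/2)W = ε/2 + B` also `γAB ≤ μ ε/2`. Moreover
  -- `1/(γμ) = AW/μ²` is exactly the factor before the logarithm in the bound on `T`.
  refine ⟨μ / (A * W), by positivity, fun Ω _ P _ u hu hlaw hind lam0 h0 T hT =>
    ⟨fun ω => BBVI.sgd_mem_domain ℓ L _ h0 _ T, ?_⟩⟩
  have hr : μ / (A * W) * μ ≤ 1 := by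
    rw [div_mul_eq_mul_div, div_le_one (by positivity)]
    nlinarith
  obtain ⟨hint, hle⟩ := BBVI.sgd_norm_sub_sq_moment hν hμ hL hconc hsmooth hz hstar_mem hstar
    (γ := μ / (A * W)) (ε := ε) (by positivity)
    (by rw [hγA]; exact div_le_self hμ.le hW1) hr
    (by
      rw [hγA, ← hB, div_mul_eq_mul_div, div_le_iff₀ hW0, mul_assoc]
      refine mul_le_mul_of_nonneg_left ?_ hμ.le
      have : ε / 2 * W = ε / 2 + B := by rw [hW]; field_simp
      linarith)
    hε.le hu hlaw hind h0 T
  refine ⟨hint, hle.trans ?_⟩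
  set Δ := ‖lam0 - lamStar‖ ^ 2 with hΔ
  suffices (1 - μ / (A * W) * μ) ^ T * Δ ≤ ε / 2 by linarith
  -- Here `Δ` is the squared distance. The value `0` is treated apart: `Real.log 0 = 0`, so the
  -- bound on `T` is then void and the logarithm cannot be inverted.
  rcases (show 0 ≤ Δ by positivity).eq_or_lt with h | hΔ0
  · rw [← h, mul_zero]; positivity
  have hpos : 0 < 2 * Δ * (1 / ε) := by positivity
  have hlog : Real.log (2 * Δ * (1 / ε)) ≤ μ / (A * W) * μ * T := by
    have e : 2 * (L / μ) ^ 2 * (d + BBVI.kurt ν + 4) * W = (μ / (A * W) * μ)⁻¹ := by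
      rw [hA]; field_simp
    rw [e, inv_mul_le_iff₀ (by positivity)] at hT
    exact hT
  calc (1 - μ / (A * W) * μ) ^ T * Δ
      ≤ Real.exp (-(μ / (A * W) * μ)) ^ T * Δ := by
        refine mul_le_mul_of_nonneg_right ?_ hΔ0.le
        exact pow_le_pow_left₀ (sub_nonneg.2 hr) (Real.one_sub_le_exp_neg _) T
    _ = Real.exp (-(μ / (A * W) * μ * T)) * Δ := by
        rw [← Real.exp_nat_mul]; congr 2; ring
    _ ≤ Real.exp (-Real.log (2 * Δ * (1 / ε))) * Δ := by gcongr
    _ = ε / 2 := by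
        rw [Real.exp_neg, Real.exp_log hpos]; field_simp
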